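/- Let $n\ge 1$ and $M\ge 2$ be integers, $X\in\mathbb R$, and let $Q:[X,\infty)\to\mathbb C\setminus\{0\}$ be of class $C^2$; fix a continuous logarithm of $Q$ on $[X,\infty)$ and let $Q^s$ denote the powers it determines. Put $\omega_k=e^{2(k-1)\pi i/n}$ $(1\le k\le n)$, $D=\mathrm{dg}(\omega_1,\dots,\omega_n)$, $\Omega=(\omega_k^{\,j-1})_{j,k}$ and $C=-\Omega^{-1}\,n^{-1}\mathrm{dg}(0,1,\dots,n-1)\,\Omega$, so that with $Y=(y,y',\dots,y^{(n-1)})^{T}=\mathrm{dg}(1,Q^{1/n},\dots,Q^{(n-1)/n})\,\Omega Z$ the equation $y^{(n)}=Qy$ becomes $Z'=Q^{1/n}(D+Q'Q^{-1-1/n}C)Z$. Here $\mathrm{dg}(\dots)$ is a diagonal matrix and $\mathrm{dg}\,A$ the diagonal part of a matrix $A$. The transformed systems are defined as follows. Let $S_2,\dots,S_M$ be $n\times n$ complex matrix functions on $[X,\infty)$ (at stage $m$, the terms of the perturbation selected for removal), with $S_2,\dots,S_{M-1}$ of class $C^1$ and $S_M$ continuous. Put $\Delta_1=0$, $R_1=V_{11}=Q'Q^{-1-1/n}(C-\mathrm{dg}\,C)$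 and, for $m\ge2$, $\Delta_m=\mathrm{dg}\,S_2+\dots+\mathrm{dg}\,S_m=\mathrm{dg}(\delta_{1m},\dots,\delta_{nm})$ and $V_{1m}=S_m-\mathrm{dg}\,S_m$. For $m\ge1$ let $$D_m=D-\tfrac{n-1}{2n}Q'Q^{-1-1/n}I+\Delta_m ,$$ let $P_m$ be the matrix with zero diagonal and $P_mD-DP_m=V_{1m}$, assume that $I+P_m$ is invertible on $[X,\infty)$ for $1\le m\le M-1$, and let $$R_{m+1}=(I+P_m)^{-1}\bigl\{-Q^{-1/n}P_m'+\Delta_mP_m-P_m\Delta_m+V_{1m}P_m+(R_m-V_{1m})(I+P_m)\bigr\}-\mathrm{dg}\,S_{m+1}.$$ Thus $Z_m=(I+P_m)Z_{m+1}$, $Z_1=Z$, takes $Z_m'=Q^{1/n}(D_m+R_m)Z_m$ into the same system with $m+1$ in place of $m$. Write $I+P=(I+P_1)(I+P_2)\cdots(I+P_{M-1})$ and $P=(p_{jk})$. Assume that on $[X,\infty)$, for all $1\le j,k\le n$, the function $$\mathrm{Re}\{(\omega_j-\omega_k+\delta_{jM}-\delta_{kM})Q^{1/n}\}$$ has constant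 sign (either $\ge0$ throughout or $\le 0$ throughout), that for $j\ne k$ $$\Bigl|\int_X^\infty \mathrm{Re}\{(\omega_j-\omega_k+\delta_{jM}-\delta_{kM})Q^{1/n}\}\,dt\Bigr|=\infty ,$$ and that (every entry of) $Q^{1/n}R_M$ is integrable on $[X,\infty)$. Then for each $1\le k\le n$ there are a solution $y_k$ of $y^{(n)}=Qy$ on $[X,\infty)$ and functions $\eta_1,\dots,\eta_n$ (depending on $k$) with $\eta_j(x)\to0$ as $x\to\infty$ such that, for all $1\le r\le n$ and $x\ge X$, $$y_k^{(r-1)}=Q^{-(n+1-2r)/(2n)}\Bigl\{\omega_k^{r-1}+\sum_{j=1}^n\omega_j^{r-1}\Bigl(\eta_j+p_{jk}+\sum_{l=1}^np_{jl}\eta_l\Bigr)\Bigr\}\exp\Bigl(\int_X^xQ^{1/n}(t)\{\omega_k+\delta_{kM}(t)\}\,dt\Bigr).$$ Moreover, with $\|R_M\|$ the largest modulus of an entry of $R_M$ and $I_0=\int_X^\infty|Q^{1/n}|\,\|R_M\|\,dt$, if $nI_0<1$ then these $\eta_j$ satisfy $$|\eta_j(x)|\le \frac{I_0}{1-nI_0}\qquad(x\ge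 X,\ 1\le j\le n).$$ -/

import Mathlib

open Set Filter Topology MeasureTheory Matrix

noncomputable section

namespace LiouvilleGreen

/-- `y` is a (classical) solution of `y⁽ⁿ⁾ = Q y` on `[X, ∞)`; derivatives at the end point `X`
are one-sided. -/
def IsSolution (n : ℕ) (X : ℝ) (Q y : ℝ → ℂ) : Prop :=
  ContDiffOn ℝ n y (Ici X) ∧
    ∀ x ∈ Ici X, iteratedDerivWithin n y (Ici X) x = Q x * y x

/-- `L` is a continuous logarithm of `Q` on `[X, ∞)`. -/
def IsLogOn (X : ℝ) (Q L : ℝ → ℂ) : Prop :=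
  ContinuousOn L (Ici X) ∧ ∀ x ∈ Ici X, Complex.exp (L x) = Q x

/-- The power `Q^s`, for the determination given by the logarithm `L` of `Q`. -/
def qpow (L : ℝ → ℂ) (s : ℂ) (x : ℝ) : ℂ := Complex.exp (s * L x)

/-- `Q^{1/n}`. -/
def qroot (n : ℕ) (L : ℝ → ℂ) (x : ℝ) : ℂ := qpow L (1 / (n : ℂ)) x

/-- `Q' Q^{-1-1/n}`. -/
def qfac (n : ℕ) (X : ℝ) (Q L : ℝ → ℂ) (x : ℝ) : ℂ :=
  derivWithin Q (Ici X) x * qpow L (-1 - 1 / (n : ℂ)) x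

/-- The `n`-th roots of unity `exp (2 k π i / n)`, indexed by `k = 0, …, n - 1`. -/
def omega (n : ℕ) (k : Fin n) : ℂ :=
  Complex.exp (2 * ((k : ℕ) : ℂ) * (Real.pi : ℂ) * Complex.I / (n : ℂ))

/-- The matrix `Ω`. -/
def Omega (n : ℕ) : Matrix (Fin n) (Fin n) ℂ :=
  Matrix.of fun j k => omega n k ^ (j : ℕ)

/-- The inverse of `Ω`, by its entries. -/
def OmegaInv (n : ℕ) : Matrix (Fin n) (Fin n) ℂ :=
  Matrix.of fun j k => (n : ℂ)⁻¹ * (omega n j ^ (k : ℕ))⁻¹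

/-- The constant matrix `C = -Ω⁻¹ {n⁻¹ dg(0, 1, …, n-1)} Ω`: the system for `Z` obtained from
`y⁽ⁿ⁾ = Q y` by `(y, y', …, y⁽ⁿ⁻¹⁾) = dg(1, Q^{1/n}, …, Q^{(n-1)/n}) Ω Z` is
`Z' = Q^{1/n} (D + Q' Q^{-1-1/n} C) Z`. -/
def Cmat (n : ℕ) : Matrix (Fin n) (Fin n) ℂ :=
  -(OmegaInv n * Matrix.diagonal (fun j : Fin n => (n : ℂ)⁻¹ * ((j : ℕ) : ℂ)) * Omega n)

/-- The diagonal part of a matrix. -/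
def dg {n : ℕ} (A : Matrix (Fin n) (Fin n) ℂ) : Matrix (Fin n) (Fin n) ℂ :=
  Matrix.diagonal A.diag

/-- Entrywise derivative on `[X, ∞)` of a matrix function. -/
def matDeriv {n : ℕ} (X : ℝ) (A : ℝ → Matrix (Fin n) (Fin n) ℂ) (x : ℝ) :
    Matrix (Fin n) (Fin n) ℂ :=
  Matrix.of fun i j => derivWithin (fun t => A t i j) (Ici X) x

/-- The largest modulus of an entry of a matrix. -/
def entryMax {n : ℕ} (A : Matrix (Fin n) (Fin n) ℂ) : ℝ :=
  ⨆ p : Fin n × Fin n, ‖A p.1 p.2‖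

/-! The sequence of transformations `Z_m = (I + P_m) Z_{m+1}` and of systems
`Z_m' = Q^{1/n} (D_m + R_m) Z_m`. The data `S m` (`m ≥ 2`) is the group of terms that one selects
at stage `m` (the dominant terms of the perturbation) to be removed by the next transformation;
its diagonal part goes into `D_m`, its off-diagonal part is `V_{1m}`. All the other objects are
determined by `Q` and this selection. -/

/-- The diagonal entries `δ_{jm}` of `Δ_m = dg S_2 + ⋯ + dg S_m`. -/
def delta {n : ℕ} (S : ℕ → ℝ → Matrix (Fin n) (Fin n) ℂ) (m : ℕ) (j : Fin n) (x : ℝ) : ℂ :=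
  ∑ i ∈ Finset.Icc 2 m, S i x j j

/-- `Δ_m = dg(δ_{1m}, …, δ_{nm})`. -/
def Delta {n : ℕ} (S : ℕ → ℝ → Matrix (Fin n) (Fin n) ℂ) (m : ℕ) (x : ℝ) :
    Matrix (Fin n) (Fin n) ℂ :=
  Matrix.diagonal fun j => delta S m j x

/-- `D_m = dg(ω_1, …, ω_n) - (n-1)(2n)⁻¹ Q' Q^{-1-1/n} I + Δ_m`. -/
def Dmat (n : ℕ) (X : ℝ) (Q L : ℝ → ℂ) (S : ℕ → ℝ → Matrix (Fin n) (Fin n) ℂ) (m : ℕ) (x : ℝ) :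
    Matrix (Fin n) (Fin n) ℂ :=
  Matrix.diagonal (omega n)
    - (((n : ℂ) - 1) * (2 * (n : ℂ))⁻¹ * qfac n X Q L x) • (1 : Matrix (Fin n) (Fin n) ℂ)
    + Delta S m x

/-- `R_1 = Q' Q^{-1-1/n} (C - dg C)`. -/
def R1 (n : ℕ) (X : ℝ) (Q L : ℝ → ℂ) (x : ℝ) : Matrix (Fin n) (Fin n) ℂ :=
  qfac n X Q L x • (Cmat n - dg (Cmat n))

/-- `V_{1m}`: it is `R_1` for `m = 1` and `S_m - dg S_m` for `m ≥ 2`. -/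
def V1 (n : ℕ) (X : ℝ) (Q L : ℝ → ℂ) (S : ℕ → ℝ → Matrix (Fin n) (Fin n) ℂ) (m : ℕ) (x : ℝ) :
    Matrix (Fin n) (Fin n) ℂ :=
  if m = 1 then R1 n X Q L x else S m x - dg (S m x)

/-- `P_m`, the solution of `P_m D - D P_m = V_{1m}`, `dg P_m = 0`. -/
def Pmat (n : ℕ) (X : ℝ) (Q L : ℝ → ℂ) (S : ℕ → ℝ → Matrix (Fin n) (Fin n) ℂ) (m : ℕ) (x : ℝ) :
    Matrix (Fin n) (Fin n) ℂ :=
  Matrix.of fun i j => if i = j then 0 else V1 n X Q L S m x i j / (omega n j - omega n i)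

/-- `T_m = Δ_m P_m - P_m Δ_m`. -/
def Tmat (n : ℕ) (X : ℝ) (Q L : ℝ → ℂ) (S : ℕ → ℝ → Matrix (Fin n) (Fin n) ℂ) (m : ℕ) (x : ℝ) :
    Matrix (Fin n) (Fin n) ℂ :=
  Delta S m x * Pmat n X Q L S m x - Pmat n X Q L S m x * Delta S m x

/-- The perturbations `R_m` (`m ≥ 1`; the value at `m = 0` is not used): the substitution
`Z_m = (I + P_m) Z_{m+1}` takes `Z_m' = Q^{1/n} (D_m + R_m) Z_m` into
`Z_{m+1}' = Q^{1/n} (D_{m+1} + R_{m+1}) Z_{m+1}`, where `D_{m+1} = D_m + dg S_{m+1}`. -/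
def Rmat (n : ℕ) (X : ℝ) (Q L : ℝ → ℂ) (S : ℕ → ℝ → Matrix (Fin n) (Fin n) ℂ) :
    ℕ → ℝ → Matrix (Fin n) (Fin n) ℂ
  | 0, _ => 0
  | 1, x => R1 n X Q L x
  | m + 2, x =>
      (1 + Pmat n X Q L S (m + 1) x)⁻¹ *
        (-((qroot n L x)⁻¹ • matDeriv X (Pmat n X Q L S (m + 1)) x)
          + Tmat n X Q L S (m + 1) x
          + V1 n X Q L S (m + 1) x * Pmat n X Q L S (m + 1) x
          + (Rmat n X Q L S (m + 1) x - V1 n X Q L S (m + 1) x)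
              * (1 + Pmat n X Q L S (m + 1) x))
      - dg (S (m + 2) x)

/-- The matrix `P = (p_{jk})` with `I + P = (I + P_1)(I + P_2) ⋯ (I + P_{M-1})`. -/
def Ptot (n : ℕ) (X : ℝ) (Q L : ℝ → ℂ) (S : ℕ → ℝ → Matrix (Fin n) (Fin n) ℂ) (M : ℕ) (x : ℝ) :
    Matrix (Fin n) (Fin n) ℂ :=
  ((List.range (M - 1)).map fun m => 1 + Pmat n X Q L S (m + 1) x).prod - 1

/-- `Re {(ω_j - ω_k + δ_{jM} - δ_{kM}) Q^{1/n}}`. -/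
def reGap (n : ℕ) (L : ℝ → ℂ) (S : ℕ → ℝ → Matrix (Fin n) (Fin n) ℂ) (M : ℕ) (j k : Fin n)
    (x : ℝ) : ℝ :=
  ((omega n j - omega n k + delta S M j x - delta S M k x) * qroot n L x).re

/-- `I = ∫_X^∞ |Q^{1/n}| ‖R_M‖ dt`. -/
def errInt (n : ℕ) (X : ℝ) (Q L : ℝ → ℂ) (S : ℕ → ℝ → Matrix (Fin n) (Fin n) ℂ) (M : ℕ) : ℝ :=
  ∫ t in Ici X, ‖qroot n L t‖ * entryMax (Rmat n X Q L S M t)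

end LiouvilleGreen

end

namespace LiouvilleGreen

/-! The proof has an algebraic half and an analytic half.

Algebra: since `P_m D - D P_m = V_{1m}`, the matrix `I + P_m` carries solutions of system `m + 1` to
solutions of system `m` (`matDeriv_add_mul`). A solution of the last system thus pulls back through
`I + P` to one of the first, and its components sum to a solution of the scalar equation
(`IsSystemSolution.isSolution`).

Analysis: dividing the last system by `Q^{-(n-1)/(2n)} exp ∫ Q^{1/n}(ω_k + δ_{kM})` leaves a
diagonal system with entries `λ_j = (ω_j - ω_k + δ_{jM} - δ_{kM}) Q^{1/n}`, where `λ_k = 0`,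
perturbed by the integrable matrix `Q^{1/n} R_M` (`isSystemSolution_of_reduced`). A solution `e_k +
η` is sought by variation of constants, each component being integrated from `∞` if `Re λ_j ≥ 0` and
from `X` otherwise (`exists_kernel`). Constant sign makes every kernel bounded by exactly `1`, and
the divergent integrals make it vanish as `x → ∞`. If `n I_0 < 1` the integral operator is a
contraction; its fixed point obeys the stated bound, and dominated convergence gives `η → 0`
(`exists_solution_of_kernel`). If `n I_0 ≥ 1`, the argument is run on a distant half-line `[Y, ∞)`
and the solution is continued back to `X` (`exists_levinson_solution`). -/

/-! ### Integral equations with bounded kernels -/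

/-- A system of linear integral equations whose kernels are bounded by `1` and vanish at infinity
has a small bounded continuous solution, provided the coefficients have small integral. -/
theorem exists_solution_of_kernel {ι : Type*} [Fintype ι] (μ : Measure ℝ) [NullSingletonClass μ]
    (K : ι → ℝ → ℝ → ℂ) (hKm : ∀ j x, Measurable (K j x))
    (hK1 : ∀ j x t, ‖K j x t‖ ≤ 1)
    (hKc : ∀ j x t, t ≠ x → ContinuousAt (fun u => K j u t) x)
    (hK0 : ∀ j t, Tendsto (fun u => K j u t) atTop (𝓝 0))
    (B : ι → ι → ℝ → ℂ) (hB : ∀ i j, AEStronglyMeasurable (B i j) μ)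
    (r : ℝ → ℝ) (hr : Integrable r μ) (hBr : ∀ i j, ∀ᵐ t ∂μ, ‖B i j t‖ ≤ r t)
    (hr0 : ∀ᵐ t ∂μ, 0 ≤ r t) (k : ι)
    (hI : (Fintype.card ι : ℝ) * ∫ t, r t ∂μ < 1) :
    ∃ η : ℝ → ι → ℂ, Continuous η ∧
      (∀ x j, η x j = ∫ t, K j x t * (B j k t + ∑ l, B j l t * η t l) ∂μ) ∧
      (∀ j, Tendsto (fun x => η x j) atTop (𝓝 0)) ∧
      ∀ x j, ‖η x j‖ ≤ (∫ t, r t ∂μ) / (1 - (Fintype.card ι : ℝ) * ∫ t, r t ∂μ) := by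
  set N : ℝ := (Fintype.card ι : ℝ) with hN
  set I : ℝ := ∫ t, r t ∂μ with hIdef
  have hN0 : 0 ≤ N := Nat.cast_nonneg _
  have hI0 : 0 ≤ I := integral_nonneg_of_ae hr0
  have hBr' : ∀ᵐ t ∂μ, ∀ i j, ‖B i j t‖ ≤ r t := by
    rw [ae_all_iff]; intro i; rw [ae_all_iff]; exact hBr i
  have hsum : ∀ (c : ℝ) (v : ι → ℂ) (t : ℝ) (j : ι), (∀ l, ‖v l‖ ≤ c) →
      (∀ i j, ‖B i j t‖ ≤ r t) → ‖∑ l, B j l t * v l‖ ≤ r t * (N * c) := by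
    intro c v t j hv hb
    calc ‖∑ l, B j l t * v l‖ ≤ ∑ l, ‖B j l t * v l‖ := norm_sum_le _ _
      _ ≤ ∑ _l : ι, r t * c := by
          refine Finset.sum_le_sum fun l _ => ?_
          rw [norm_mul]
          exact mul_le_mul (hb j l) (hv l) (norm_nonneg _) ((norm_nonneg _).trans (hb j l))
      _ = r t * (N * c) := by simp [hN]; ring
  have hFm : ∀ (g : ℝ → ι → ℂ), Continuous g → ∀ j x,
      AEStronglyMeasurable (fun t => K j x t * (B j k t + ∑ l, B j l t * g t l)) μ := by
    intro g hg j x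
    refine (hKm j x).aestronglyMeasurable.mul ((hB j k).add ?_)
    refine Finset.aestronglyMeasurable_fun_sum _ fun l _ => (hB j l).mul ?_
    exact ((continuous_apply l).comp hg).aestronglyMeasurable
  have hFb : ∀ (g : ℝ → ι → ℂ) (c : ℝ), (∀ t l, ‖g t l‖ ≤ c) → ∀ j x,
      ∀ᵐ t ∂μ, ‖K j x t * (B j k t + ∑ l, B j l t * g t l)‖ ≤ r t * (1 + N * c) := by
    intro g c hc j x
    filter_upwards [hBr'] with t ht
    rw [norm_mul]
    calc ‖K j x t‖ * ‖B j k t + ∑ l, B j l t * g t l‖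
        ≤ 1 * (r t + r t * (N * c)) := by
          refine mul_le_mul (hK1 j x t) ?_ (norm_nonneg _) zero_le_one
          exact (norm_add_le _ _).trans (add_le_add (ht j k) (hsum c _ t j (hc t) ht))
      _ = r t * (1 + N * c) := by ring
  have hcont : ∀ (g : ℝ → ι → ℂ) (c : ℝ), Continuous g → (∀ t l, ‖g t l‖ ≤ c) →
      Continuous fun x => (fun j => ∫ t, K j x t * (B j k t + ∑ l, B j l t * g t l) ∂μ) := by
    intro g c hg hc
    refine continuous_pi fun j => continuous_iff_continuousAt.2 fun x => ?_
    refine continuousAt_of_dominated (bound := fun t => r t * (1 + N * c))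
      (Eventually.of_forall fun u => hFm g hg j u)
      (Eventually.of_forall fun u => hFb g c hc j u) (hr.mul_const _) ?_
    -- The kernel can jump only at `t = x`, which is a null set because `μ` has no point masses.
    have : ∀ᵐ t ∂μ, t ≠ x := by
      simp [ae_iff]
    filter_upwards [this] with t ht
    exact (hKc j x t ht).mul continuousAt_const
  have hnorm : ∀ (g : ℝ → ι → ℂ) (c : ℝ), (∀ t l, ‖g t l‖ ≤ c) → ∀ j x,
      ‖∫ t, K j x t * (B j k t + ∑ l, B j l t * g t l) ∂μ‖ ≤ I * (1 + N * c) := by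
    intro g c hc j x
    rw [hIdef, ← integral_mul_const]
    exact norm_integral_le_of_norm_le (hr.mul_const _) (hFb g c hc j x)
  have hbcf : ∀ (g : BoundedContinuousFunction ℝ (ι → ℂ)) t l, ‖g t l‖ ≤ ‖g‖ :=
    fun g t l => (norm_le_pi_norm _ l).trans (g.norm_coe_le_norm t)
  have hnn : ∀ g : BoundedContinuousFunction ℝ (ι → ℂ), 0 ≤ I * (1 + N * ‖g‖) :=
    fun g => by positivity
  let T : BoundedContinuousFunction ℝ (ι → ℂ) → BoundedContinuousFunction ℝ (ι → ℂ) := fun g =>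
    BoundedContinuousFunction.ofNormedAddCommGroup
      (fun x j => ∫ t, K j x t * (B j k t + ∑ l, B j l t * g t l) ∂μ)
      (hcont g ‖g‖ g.continuous (hbcf g)) (I * (1 + N * ‖g‖))
      (fun x => (pi_norm_le_iff_of_nonneg (hnn g)).2 fun j => hnorm g ‖g‖ (hbcf g) j x)
  have hT : ∀ g x j, T g x j = ∫ t, K j x t * (B j k t + ∑ l, B j l t * g t l) ∂μ :=
    fun g x j => rfl
  -- Each row has `N` entries bounded by `r` and the kernel is at most `1`, so in the sup norm the
  -- constant is `N ∫ r`.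
  have hLip : LipschitzWith (NNReal.mk (N * I) (by positivity)) T := by
    refine LipschitzWith.of_dist_le_mul fun f g => ?_
    have h0 : 0 ≤ N * I * dist f g := by positivity
    rw [NNReal.coe_mk, BoundedContinuousFunction.dist_le h0]
    intro x
    rw [dist_eq_norm, pi_norm_le_iff_of_nonneg h0]
    intro j
    rw [Pi.sub_apply, hT, hT, ← integral_sub
      ((hr.mul_const _).mono' (hFm f f.continuous j x) (hFb f ‖f‖ (hbcf f) j x))
      ((hr.mul_const _).mono' (hFm g g.continuous j x) (hFb g ‖g‖ (hbcf g) j x))]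
    have : N * I * dist f g = ∫ t, r t * (N * dist f g) ∂μ := by
      rw [integral_mul_const]; ring
    rw [this]
    refine norm_integral_le_of_norm_le (hr.mul_const _) ?_
    filter_upwards [hBr'] with t ht
    have e : K j x t * (B j k t + ∑ l, B j l t * f t l) - K j x t * (B j k t + ∑ l, B j l t * g t l)
        = K j x t * ∑ l, B j l t * (f t - g t) l := by
      simp only [Pi.sub_apply, mul_sub, Finset.sum_sub_distrib]; ring
    rw [e, norm_mul]
    have h1 : ‖∑ l, B j l t * (f t - g t) l‖ ≤ r t * (N * dist f g) := by
      refine hsum _ _ t j (fun l => ?_) ht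
      refine (norm_le_pi_norm _ l).trans ?_
      rw [← dist_eq_norm]
      exact BoundedContinuousFunction.dist_coe_le_dist t
    calc ‖K j x t‖ * ‖∑ l, B j l t * (f t - g t) l‖ ≤ 1 * (r t * (N * dist f g)) :=
          mul_le_mul (hK1 j x t) h1 (norm_nonneg _) zero_le_one
      _ = _ := one_mul _
  have hC : ContractingWith (NNReal.mk (N * I) (by positivity)) T := ⟨by
    rw [← NNReal.coe_lt_coe]; exact hI, hLip⟩
  set g := ContractingWith.fixedPoint T hC with hg
  have hfix : T g = g := hC.fixedPoint_isFixedPt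
  have hgeq : ∀ x j, g x j = ∫ t, K j x t * (B j k t + ∑ l, B j l t * g t l) ∂μ := by
    intro x j
    rw [← hT, hfix]
  refine ⟨g, g.continuous, hgeq, fun j => ?_, fun x j => ?_⟩
  · have h0 : (0 : ℂ) = ∫ _t, (0 : ℂ) ∂μ := by simp
    rw [h0]
    simp_rw [hgeq _ j]
    refine tendsto_integral_filter_of_dominated_convergence (fun t => r t * (1 + N * ‖g‖))
      (Eventually.of_forall fun u => hFm g g.continuous j u)
      (Eventually.of_forall fun u => hFb g ‖g‖ (hbcf g) j u) (hr.mul_const _) ?_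
    refine Eventually.of_forall fun t => ?_
    simpa using (hK0 j t).mul_const (B j k t + ∑ l, B j l t * g t l)
  -- The fixed point equation bounds `‖g‖` in terms of itself; `N * I < 1` allows solving for `‖g‖`.
  · have h1 : ‖g‖ ≤ I * (1 + N * ‖g‖) := by
      rw [BoundedContinuousFunction.norm_le (hnn g)]
      intro x
      rw [pi_norm_le_iff_of_nonneg (hnn g)]
      intro j
      rw [hgeq]
      exact hnorm g ‖g‖ (hbcf g) j x
    refine (hbcf g x j).trans ?_
    rw [le_div_iff₀ (by linarith)]
    linarith

/-! ### Kernels from variation of constants -/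

theorem hasDerivAt_integral_of_continuous {f : ℝ → ℂ} (hf : Continuous f) (X x : ℝ) :
    HasDerivAt (fun u => ∫ t in X..u, f t) (f x) x :=
  intervalIntegral.integral_hasDerivAt_right (hf.intervalIntegrable _ _)
    (hf.stronglyMeasurableAtFilter _ _) hf.continuousAt

theorem re_integral_sub {f : ℝ → ℂ} (hf : Continuous f) (X x t : ℝ) :
    ((∫ s in X..x, f s) - ∫ s in X..t, f s).re = ∫ s in t..x, (f s).re := by
  rw [intervalIntegral.integral_interval_sub_left (hf.intervalIntegrable _ _)
    (hf.intervalIntegrable _ _)]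
  exact (Complex.reCLM.intervalIntegral_comp_comm (hf.intervalIntegrable t x)).symm

/-- The variation of constants integral `e^{Λ(x)} (c + ∫_X^x e^{-Λ(t)} b(t) dt)`. -/
theorem hasDerivAt_variation_of_constants {lam b : ℝ → ℂ} (hlam : Continuous lam)
    (hb : Continuous b) (X : ℝ) (c : ℂ) (x : ℝ) :
    HasDerivAt (fun u => Complex.exp (∫ t in X..u, lam t) *
        (c + ∫ t in X..u, Complex.exp (-∫ s in X..t, lam s) * b t))
      (lam x * (Complex.exp (∫ t in X..x, lam t) *
        (c + ∫ t in X..x, Complex.exp (-∫ s in X..t, lam s) * b t)) + b x) x := by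
  have h1 := (hasDerivAt_integral_of_continuous hlam X x).cexp
  have hc : Continuous fun t => Complex.exp (-∫ s in X..t, lam s) * b t := by
    have : Continuous fun t => ∫ s in X..t, lam s :=
      continuous_iff_continuousAt.2 fun t =>
        (hasDerivAt_integral_of_continuous hlam X t).continuousAt
    fun_prop
  have h2 := (hasDerivAt_integral_of_continuous hc X x).const_add c
  refine (h1.mul h2).congr_deriv ?_
  have : Complex.exp (∫ t in X..x, lam t) * (Complex.exp (-∫ s in X..x, lam s) * b x) = b x := by
    rw [← mul_assoc, ← Complex.exp_add]; simp
  rw [this]; ring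

/-- A solution operator of `u' = lam u + b` on `[X, ∞)` with kernel bounded by `1` and vanishing
at infinity. -/
theorem exists_kernel {lam : ℝ → ℂ} (hlam : Continuous lam) (X : ℝ)
    (hsign : (∀ t, 0 ≤ (lam t).re) ∨
      ((∀ t, (lam t).re ≤ 0) ∧ Tendsto (fun x => ∫ t in X..x, (lam t).re) atTop atBot)) :
    ∃ K : ℝ → ℝ → ℂ, (∀ x, Measurable (K x)) ∧ (∀ x t, ‖K x t‖ ≤ 1) ∧
      (∀ x t, t ≠ x → ContinuousAt (fun u => K u t) x) ∧
      (∀ t, Tendsto (fun u => K u t) atTop (𝓝 0)) ∧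
      ∀ b : ℝ → ℂ, Continuous b → IntegrableOn b (Ici X) → ∀ x ∈ Ici X,
        HasDerivWithinAt (fun u => ∫ t in Ici X, K u t * b t)
          (lam x * (∫ t in Ici X, K x t * b t) + b x) (Ici X) x := by
  set Λ : ℝ → ℂ := fun x => ∫ t in X..x, lam t with hΛ
  have hΛc : Continuous Λ := continuous_iff_continuousAt.2 fun t =>
        (hasDerivAt_integral_of_continuous hlam X t).continuousAt
  have hre : ∀ x t, (Λ x - Λ t).re = ∫ s in t..x, (lam s).re := fun x t =>
    re_integral_sub hlam X x t
  have hrec : Continuous fun t => (lam t).re := Complex.continuous_re.comp hlam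
  rcases hsign with hs | ⟨hs, hlim⟩
  -- Nondecaying mode: integrate from `∞`. For fixed `t` the kernel is zero once `x ≥ t`, so no
  -- divergence is needed.
  · refine ⟨fun x t => if x < t then -Complex.exp (Λ x - Λ t) else 0, fun x => ?_, fun x t => ?_,
      fun x t htx => ?_, fun t => ?_, fun b hb hbi x hx => ?_⟩
    · exact Measurable.ite measurableSet_Ioi (by fun_prop) measurable_const
    · beta_reduce
      split_ifs with h
      · rw [norm_neg, Complex.norm_exp, Real.exp_le_one_iff, hre, intervalIntegral.integral_symm,
          neg_nonpos]
        exact intervalIntegral.integral_nonneg h.le fun s _ => hs s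
      · simp
    · rcases lt_or_gt_of_ne htx with h | h
      · have : (fun u => if u < t then -Complex.exp (Λ u - Λ t) else 0) =ᶠ[𝓝 x] fun _ => 0 := by
          filter_upwards [lt_mem_nhds h] with u hu
          rw [if_neg hu.not_gt]
        exact this.continuousAt
      · have : (fun u => if u < t then -Complex.exp (Λ u - Λ t) else 0) =ᶠ[𝓝 x]
            fun u => -Complex.exp (Λ u - Λ t) := by
          filter_upwards [gt_mem_nhds h] with u hu
          rw [if_pos hu]
        refine ContinuousAt.congr ?_ this.symm
        fun_prop
    · refine tendsto_const_nhds.congr' ?_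
      filter_upwards [eventually_gt_atTop t] with u hu
      rw [if_neg hu.not_gt]
    -- Since `Λ X = 0` and `Re λ ≥ 0`, the factor `e^{-Λ}` is bounded by `1` on the half-line.
    · have hint : IntegrableOn (fun t => Complex.exp (-Λ t) * b t) (Ioi X) := by
        refine Integrable.mono (hbi.mono_set Ioi_subset_Ici_self) (by fun_prop) ?_
        rw [ae_restrict_iff' measurableSet_Ioi]
        refine Eventually.of_forall fun t ht => ?_
        rw [norm_mul, Complex.norm_exp]
        refine mul_le_of_le_one_left (norm_nonneg _) ?_
        rw [Real.exp_le_one_iff, Complex.neg_re, neg_nonpos]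
        have := hre t X
        simp only [hΛ, intervalIntegral.integral_same, sub_zero] at this
        rw [this]
        exact intervalIntegral.integral_nonneg (le_of_lt ht) fun s _ => hs s
      have key : ∀ u ∈ Ici X, ∫ t in Ici X, (if u < t then -Complex.exp (Λ u - Λ t) else 0) * b t
          = Complex.exp (Λ u) * (-(∫ t in Ioi X, Complex.exp (-Λ t) * b t)
            + ∫ t in X..u, Complex.exp (-Λ t) * b t) := by
        intro u hu
        have e1 : ∀ t, (if u < t then -Complex.exp (Λ u - Λ t) else 0) * b t =
            (Ioi u).indicator (fun t => -Complex.exp (Λ u) * (Complex.exp (-Λ t) * b t)) t := by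
          intro t
          by_cases h : u < t
          · rw [if_pos h, indicator_of_mem (mem_Ioi.2 h), sub_eq_add_neg, Complex.exp_add]; ring
          · rw [if_neg h, indicator_of_notMem (by simpa using h), zero_mul]
        simp_rw [e1]
        rw [setIntegral_indicator measurableSet_Ioi, inter_eq_right.2
          (Ioi_subset_Ici hu), integral_const_mul,
          ← intervalIntegral.integral_Ioi_sub_Ioi hint hu]
        ring
      refine HasDerivWithinAt.congr ?_ key (key x hx)
      rw [key x hx]
      exact (hasDerivAt_variation_of_constants hlam hb X _ x).hasDerivWithinAt
  -- Nongrowing mode: integrate from `X`. Here the kernel vanishes at infinity only because `∫ Re λ`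
  -- diverges to `-∞`.
  · refine ⟨fun x t => if t < x then Complex.exp (Λ x - Λ t) else 0, fun x => ?_, fun x t => ?_,
      fun x t htx => ?_, fun t => ?_, fun b hb hbi x hx => ?_⟩
    · exact Measurable.ite measurableSet_Iio (by fun_prop) measurable_const
    · beta_reduce
      split_ifs with h
      · rw [Complex.norm_exp, Real.exp_le_one_iff, hre]
        have := intervalIntegral.integral_nonneg (μ := volume) h.le
          (f := fun s => -(lam s).re) fun s _ => by simpa using hs s
        rw [intervalIntegral.integral_neg] at this
        linarith
      · simp
    · rcases lt_or_gt_of_ne htx with h | h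
      · have : (fun u => if t < u then Complex.exp (Λ u - Λ t) else 0) =ᶠ[𝓝 x]
            fun u => Complex.exp (Λ u - Λ t) := by
          filter_upwards [lt_mem_nhds h] with u hu
          rw [if_pos hu]
        refine ContinuousAt.congr ?_ this.symm
        fun_prop
      · have : (fun u => if t < u then Complex.exp (Λ u - Λ t) else 0) =ᶠ[𝓝 x] fun _ => 0 := by
          filter_upwards [gt_mem_nhds h] with u hu
          rw [if_neg hu.not_gt]
        exact this.continuousAt
    · rw [tendsto_zero_iff_norm_tendsto_zero]
      have h1 : Tendsto (fun u => Real.exp ((∫ s in X..u, (lam s).re) - ∫ s in X..t, (lam s).re))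
          atTop (𝓝 0) :=
        Real.tendsto_exp_atBot.comp (tendsto_atBot_add_const_right _ _ hlim)
      refine h1.congr' ?_
      filter_upwards [eventually_gt_atTop t] with u hu
      rw [if_pos hu, Complex.norm_exp, hre, intervalIntegral.integral_interval_sub_left
        (hrec.intervalIntegrable _ _) (hrec.intervalIntegrable _ _)]
    · have key : ∀ u ∈ Ici X, ∫ t in Ici X, (if t < u then Complex.exp (Λ u - Λ t) else 0) * b t
          = Complex.exp (Λ u) * (0 + ∫ t in X..u, Complex.exp (-Λ t) * b t) := by
        intro u hu
        have e1 : ∀ t, (if t < u then Complex.exp (Λ u - Λ t) else 0) * b t =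
            (Iio u).indicator (fun t => Complex.exp (Λ u) * (Complex.exp (-Λ t) * b t)) t := by
          intro t
          by_cases h : t < u
          · rw [if_pos h, indicator_of_mem (mem_Iio.2 h), sub_eq_add_neg, Complex.exp_add]; ring
          · rw [if_neg h, indicator_of_notMem (by simpa using h), zero_mul]
        simp_rw [e1]
        rw [setIntegral_indicator measurableSet_Iio, Ici_inter_Iio, integral_const_mul,
          intervalIntegral.integral_of_le hu, integral_Ico_eq_integral_Ioo,
          integral_Ioc_eq_integral_Ioo, zero_add]
      refine HasDerivWithinAt.congr ?_ key (key x hx)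
      rw [key x hx]
      exact (hasDerivAt_variation_of_constants hlam hb X _ x).hasDerivWithinAt

/-! ### Levinson's theorem for small perturbations -/

/-- Levinson's theorem, quantitative form: a system close to a diagonal one satisfying the
dichotomy condition. -/
theorem exists_solution_of_small_perturbation {ι : Type*} [Fintype ι] (X : ℝ) (lam : ι → ℝ → ℂ)
    (hlam : ∀ j, Continuous (lam j)) (B : ι → ι → ℝ → ℂ) (hB : ∀ i j, Continuous (B i j))
    (r : ℝ → ℝ) (hr : IntegrableOn r (Ici X)) (hBr : ∀ i j, ∀ t ∈ Ici X, ‖B i j t‖ ≤ r t)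
    (hsign : ∀ j, (∀ t, 0 ≤ (lam j t).re) ∨
      ((∀ t, (lam j t).re ≤ 0) ∧ Tendsto (fun x => ∫ t in X..x, (lam j t).re) atTop atBot))
    (k : ι) (hI : (Fintype.card ι : ℝ) * ∫ t in Ici X, r t < 1) :
    ∃ η : ℝ → ι → ℂ,
      (∀ x ∈ Ici X, ∀ j, HasDerivWithinAt (fun u => η u j)
        (lam j x * η x j + (B j k x + ∑ l, B j l x * η x l)) (Ici X) x) ∧
      (∀ j, Tendsto (fun x => η x j) atTop (𝓝 0)) ∧
      ∀ x j, ‖η x j‖ ≤ (∫ t in Ici X, r t) /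
        (1 - (Fintype.card ι : ℝ) * ∫ t in Ici X, r t) := by
  choose K hKm hK1 hKc hK0 hKd using fun j => exists_kernel (hlam j) X (hsign j)
  have hBr' : ∀ i j, ∀ᵐ t ∂(volume.restrict (Ici X)), ‖B i j t‖ ≤ r t := fun i j =>
    (ae_restrict_iff' measurableSet_Ici).2 (Eventually.of_forall (hBr i j))
  have hBi : ∀ i j, IntegrableOn (B i j) (Ici X) := fun i j =>
    hr.mono' (hB i j).aestronglyMeasurable (hBr' i j)
  obtain ⟨η, hηc, hηe, hη0, hηb⟩ := exists_solution_of_kernel (volume.restrict (Ici X)) K hKm hK1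
    hKc hK0 B (fun i j => (hB i j).aestronglyMeasurable) r hr hBr'
    ((hBr' k k).mono fun t ht => (norm_nonneg _).trans ht) k hI
  refine ⟨η, fun x hx j => ?_, hη0, hηb⟩
  have hcont : ∀ l, Continuous fun t => η t l := fun l => (continuous_apply l).comp hηc
  have hint : IntegrableOn (fun t => B j k t + ∑ l, B j l t * η t l) (Ici X) := by
    refine (hBi j k).add (integrable_finsetSum _ fun l _ => ?_)
    exact (hBi j l).mul_bdd (hcont l).aestronglyMeasurable
      (Eventually.of_forall fun t => hηb t l)
  have h := hKd j (fun t => B j k t + ∑ l, B j l t * η t l) (by fun_prop) hint x hx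
  simp_rw [← hηe _ j] at h
  exact h

/-! ### Backward continuation of linear systems -/

theorem norm_mulVec_le {ι : Type*} [Fintype ι] (A : Matrix ι ι ℂ) (v : ι → ℂ) :
    ‖A *ᵥ v‖ ≤ (∑ i, ∑ j, ‖A i j‖) * ‖v‖ := by
  have h0 : ∀ i, 0 ≤ ∑ j, ‖A i j‖ := fun i => Finset.sum_nonneg fun j _ => norm_nonneg _
  refine (pi_norm_le_iff_of_nonneg (mul_nonneg (Finset.sum_nonneg fun i _ => h0 i)
    (norm_nonneg _))).2 fun i => ?_
  calc ‖(A *ᵥ v) i‖ = ‖∑ j, A i j * v j‖ := rfl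
    _ ≤ ∑ j, ‖A i j * v j‖ := norm_sum_le _ _
    _ ≤ ∑ j, ‖A i j‖ * ‖v‖ := Finset.sum_le_sum fun j _ => by
        rw [norm_mul]; exact mul_le_mul_of_nonneg_left (norm_le_pi_norm v j) (norm_nonneg _)
    _ = (∑ j, ‖A i j‖) * ‖v‖ := by rw [Finset.sum_mul]
    _ ≤ _ := mul_le_mul_of_nonneg_right
        (Finset.single_le_sum (fun i _ => h0 i) (Finset.mem_univ i)) (norm_nonneg _)

/-- Outside a closed set the derivative within that set is vacuous, so when gluing on a union of two
closed pieces each piece need only be checked at its own points. -/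
theorem hasDerivWithinAt_of_eqOn_of_isClosed {E : Type*} [NormedAddCommGroup E] [NormedSpace ℝ E]
    {f g : ℝ → E} {e : E} {s : Set ℝ} (hs : IsClosed s) (hfg : EqOn f g s) {x : ℝ}
    (h : x ∈ s → HasDerivWithinAt g e s x) : HasDerivWithinAt f e s x := by
  by_cases hx : x ∈ s
  · exact (h hx).congr hfg (hfg hx)
  · exact HasFDerivWithinAt.of_notMem_closure (by rwa [hs.closure_eq])

/-- Gluing of two solutions of an equation `v' = F(x, v)`. -/
theorem exists_glued_solution {E : Type*} [NormedAddCommGroup E] [NormedSpace ℝ E]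
    {F : ℝ → E → E} {a c : ℝ} (hac : a ≤ c) {u v : ℝ → E} (huv : u c = v c)
    (hu : ∀ x ∈ Icc a c, HasDerivWithinAt u (F x (u x)) (Icc a c) x)
    (hv : ∀ x ∈ Ici c, HasDerivWithinAt v (F x (v x)) (Ici c) x) :
    ∃ w : ℝ → E, EqOn w v (Ici c) ∧
      ∀ x ∈ Ici a, HasDerivWithinAt w (F x (w x)) (Ici a) x := by
  classical
  set w : ℝ → E := fun x => if x < c then u x else v x with hw
  have h1 : EqOn w u (Icc a c) := by
    intro x hx
    by_cases h : x < c
    · simp [hw, h]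
    · have : x = c := le_antisymm hx.2 (not_lt.1 h)
      simp [hw, this, huv]
  have h2 : EqOn w v (Ici c) := fun x hx => by
    have : ¬ x < c := not_lt.2 hx
    simp [hw, this]
  refine ⟨w, h2, fun x _ => ?_⟩
  rw [← Icc_union_Ici_eq_Ici hac]
  refine (hasDerivWithinAt_of_eqOn_of_isClosed isClosed_Icc h1 fun hx => ?_).union
    (hasDerivWithinAt_of_eqOn_of_isClosed isClosed_Ici h2 fun hx => ?_)
  · rw [h1 hx]; exact hu x hx
  · rw [h2 hx]; exact hv x hx

/-- Backward continuation of solutions of a linear system. -/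
theorem exists_linear_continuation {ι : Type*} [Fintype ι] {A : ℝ → Matrix ι ι ℂ}
    (hA : ∀ i j, Continuous fun x => A x i j) {X c : ℝ} (hXc : X ≤ c) {v : ℝ → ι → ℂ}
    (hv : ∀ x ∈ Ici c, HasDerivWithinAt v (A x *ᵥ v x) (Ici c) x) :
    ∃ w : ℝ → ι → ℂ, EqOn w v (Ici c) ∧
      ∀ x ∈ Ici X, HasDerivWithinAt w (A x *ᵥ w x) (Ici X) x := by
  obtain ⟨K, hK⟩ : ∃ K : ℝ, ∀ t ∈ Icc X c, ∑ i, ∑ j, ‖A t i j‖ ≤ K := by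
    have hc : Continuous fun t => ∑ i, ∑ j, ‖A t i j‖ := by fun_prop
    obtain ⟨K, hK⟩ := isCompact_Icc.bddAbove_image hc.continuousOn
    exact ⟨K, fun t ht => hK (mem_image_of_mem _ ht)⟩
  -- The added `1` keeps `κ` positive, so the step length `1 / (2κ)` is meaningful.
  set κ : NNReal := Real.toNNReal K + 1 with hκ
  have hκ0 : (0 : ℝ) < κ := by rw [hκ]; positivity
  have hκA : ∀ t ∈ Icc X c, ∀ u, ‖A t *ᵥ u‖ ≤ κ * ‖u‖ := fun t ht u =>
    (norm_mulVec_le _ _).trans (mul_le_mul_of_nonneg_right ((hK t ht).trans (by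
      rw [hκ, NNReal.coe_add, NNReal.coe_one]
      linarith [Real.le_coe_toNNReal K])) (norm_nonneg _))
  -- By linearity the existence time `1 / (2κ)` does not depend on the size of the solution, so
  -- finitely many equal steps reach `X`.
  have step : ∀ N : ℕ, ∀ b ∈ Icc X c, b - X ≤ N * (1 / (2 * κ : ℝ)) → ∀ v : ℝ → ι → ℂ,
      (∀ x ∈ Ici b, HasDerivWithinAt v (A x *ᵥ v x) (Ici b) x) →
      ∃ w : ℝ → ι → ℂ, EqOn w v (Ici b) ∧
        ∀ x ∈ Ici X, HasDerivWithinAt w (A x *ᵥ w x) (Ici X) x := by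
    intro N
    induction N with
    | zero =>
      intro b hb hbX v hv
      have : b = X := le_antisymm (by simpa using hbX) hb.1
      subst this
      exact ⟨v, fun _ _ => rfl, hv⟩
    | succ N ih =>
      intro b hb hbX v hv
      set a := max X (b - 1 / (2 * κ : ℝ)) with ha
      have hpos : (0 : ℝ) < 1 / (2 * κ : ℝ) := by positivity
      have hab : a ≤ b := max_le hb.1 (by linarith)
      have haX : X ≤ a := le_max_left _ _
      have hba : b - a ≤ 1 / (2 * κ : ℝ) := by
        have := le_max_right X (b - 1 / (2 * κ : ℝ)); linarith
      -- On the ball of radius `‖v b‖` about `v b` the norm is at most `2 ‖v b‖`, hence the speed is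
      -- at most `2 κ ‖v b‖`; within time `1 / (2κ)` the solution cannot leave the ball.
      have hPL : IsPicardLindelof (fun t u => A t *ᵥ u) (tmin := a) (tmax := b)
          ⟨b, right_mem_Icc.2 hab⟩ (v b) ‖v b‖₊ 0 (κ * (2 * ‖v b‖₊)) κ := by
        have hmem : ∀ t ∈ Icc a b, t ∈ Icc X c := fun t ht =>
          ⟨haX.trans ht.1, ht.2.trans hb.2⟩
        constructor
        · intro t ht
          refine LipschitzOnWith.of_dist_le_mul fun x _ y _ => ?_
          rw [dist_eq_norm, dist_eq_norm, ← Matrix.mulVec_sub]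
          exact hκA t (hmem t ht) _
        · intro x _
          refine Continuous.continuousOn (continuous_pi fun i => ?_)
          simp only [Matrix.mulVec, dotProduct]
          fun_prop
        · intro t ht x hx
          refine (hκA t (hmem t ht) x).trans ?_
          rw [NNReal.coe_mul, NNReal.coe_mul, coe_nnnorm, NNReal.coe_ofNat]
          refine mul_le_mul_of_nonneg_left ?_ hκ0.le
          rw [mem_closedBall_iff_norm, coe_nnnorm] at hx
          have := norm_add_le (x - v b) (v b)
          rw [sub_add_cancel] at this
          linarith
        · rw [sub_self, max_eq_right (sub_nonneg.2 hab)]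
          rw [NNReal.coe_mul, NNReal.coe_mul, coe_nnnorm, NNReal.coe_ofNat, NNReal.coe_zero,
            sub_zero]
          calc (κ : ℝ) * (2 * ‖v b‖) * (b - a) ≤ κ * (2 * ‖v b‖) * (1 / (2 * κ : ℝ)) :=
                mul_le_mul_of_nonneg_left hba (by positivity)
            _ = ‖v b‖ := by field_simp
      obtain ⟨u, hub, hu⟩ := hPL.exists_eq_forall_mem_Icc_hasDerivWithinAt₀
      obtain ⟨w, hwv, hw⟩ := exists_glued_solution (F := fun t u => A t *ᵥ u) hab hub hu hv
      have haN : a - X ≤ N * (1 / (2 * κ : ℝ)) := by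
        rw [ha]
        rcases max_cases X (b - 1 / (2 * κ : ℝ)) with ⟨h, _⟩ | ⟨h, _⟩ <;> rw [h]
        · rw [sub_self]; positivity
        · push_cast at hbX; linarith
      obtain ⟨w', hw'w, hw'⟩ := ih a ⟨haX, hab.trans hb.2⟩ haN w hw
      exact ⟨w', fun x hx => (hw'w (Ici_subset_Ici.2 hab hx)).trans (hwv hx), hw'⟩
  obtain ⟨N, hN⟩ := exists_nat_ge ((c - X) / (1 / (2 * κ : ℝ)))
  exact step N c ⟨hXc, le_rfl⟩ ((div_le_iff₀ (by positivity)).1 hN) v hv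

/-! ### Levinson's theorem on the whole half-line -/

/-- Freezing a coefficient to the left of `X` makes it continuous on the whole line, as the
preceding results require, without changing it on `[X, ∞)`. -/
theorem continuous_comp_max {f : ℝ → ℂ} {X : ℝ} (hf : ContinuousOn f (Ici X)) :
    Continuous fun x => f (max x X) :=
  hf.comp_continuous (by fun_prop) fun x => le_max_right x X

theorem tendsto_setIntegral_Ici_zero {r : ℝ → ℝ} {X : ℝ} (hr : IntegrableOn r (Ici X)) :
    Tendsto (fun x => ∫ t in Ici x, r t) atTop (𝓝 0) := by
  have hr' : IntegrableOn r (Ioi X) := hr.mono_set Ioi_subset_Ici_self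
  have h := (intervalIntegral_tendsto_integral_Ioi X hr' tendsto_id).const_sub
    (∫ t in Ioi X, r t)
  rw [sub_self] at h
  refine h.congr' ?_
  filter_upwards [eventually_ge_atTop X] with x hx
  rw [integral_Ici_eq_integral_Ioi, id, ← intervalIntegral.integral_Ioi_sub_Ioi hr' hx]
  ring

/-- Levinson's theorem on `[X, ∞)`, in the form `v = e_k + η` for the system
`v' = (diag lam + B) v` with `lam k = 0`. -/
theorem exists_levinson_solution {ι : Type*} [Fintype ι] (X : ℝ) (lam : ι → ℝ → ℂ)
    (hlam : ∀ j, ContinuousOn (lam j) (Ici X)) (B : ι → ι → ℝ → ℂ)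
    (hB : ∀ i j, ContinuousOn (B i j) (Ici X))
    (r : ℝ → ℝ) (hr : IntegrableOn r (Ici X)) (hBr : ∀ i j, ∀ t ∈ Ici X, ‖B i j t‖ ≤ r t)
    (hsign : ∀ j, (∀ t ∈ Ici X, 0 ≤ (lam j t).re) ∨
      ((∀ t ∈ Ici X, (lam j t).re ≤ 0) ∧
        Tendsto (fun x => ∫ t in X..x, (lam j t).re) atTop atBot))
    (k : ι) (hk : ∀ x ∈ Ici X, lam k x = 0) :
    ∃ η : ℝ → ι → ℂ,
      (∀ x ∈ Ici X, ∀ j, HasDerivWithinAt (fun u => η u j)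
        (lam j x * η x j + (B j k x + ∑ l, B j l x * η x l)) (Ici X) x) ∧
      (∀ j, Tendsto (fun x => η x j) atTop (𝓝 0)) ∧
      ((Fintype.card ι : ℝ) * ∫ t in Ici X, r t < 1 → ∀ j, ∀ x ∈ Ici X,
        ‖η x j‖ ≤ (∫ t in Ici X, r t) / (1 - (Fintype.card ι : ℝ) * ∫ t in Ici X, r t)) := by
  classical
  have hmax : ∀ x ∈ Ici X, max x X = x := fun x hx => max_eq_left hx
  have hint : ∀ (j : ι) (a b : ℝ), X ≤ a → X ≤ b →
      IntervalIntegrable (fun t => (lam j t).re) volume a b := by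
    intro j a b ha hb
    refine ContinuousOn.intervalIntegrable ?_
    refine (Complex.continuous_re.comp_continuousOn (hlam j)).mono fun t ht => ?_
    exact (le_min ha hb).trans ht.1
  have main : ∀ Y, X ≤ Y → (Fintype.card ι : ℝ) * ∫ t in Ici Y, r t < 1 →
      ∃ η : ℝ → ι → ℂ,
      (∀ x ∈ Ici Y, ∀ j, HasDerivWithinAt (fun u => η u j)
        (lam j x * η x j + (B j k x + ∑ l, B j l x * η x l)) (Ici Y) x) ∧
      (∀ j, Tendsto (fun x => η x j) atTop (𝓝 0)) ∧
      ∀ x j, ‖η x j‖ ≤ (∫ t in Ici Y, r t) /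
        (1 - (Fintype.card ι : ℝ) * ∫ t in Ici Y, r t) := by
    intro Y hXY hY
    obtain ⟨η, h1, h2, h3⟩ := exists_solution_of_small_perturbation Y
      (fun j x => lam j (max x X)) (fun j => continuous_comp_max (hlam j))
      (fun i j x => B i j (max x X)) (fun i j => continuous_comp_max (hB i j)) r
      (hr.mono_set (Ici_subset_Ici.2 hXY))
      (fun i j t ht => by
        have ht' : t ∈ Ici X := Ici_subset_Ici.2 hXY ht
        rw [hmax t ht']; exact hBr i j t ht')
      (fun j => by
        refine (hsign j).imp (fun h t => h _ (mem_Ici.2 (le_max_right t X))) fun h =>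
          ⟨fun t => h.1 _ (mem_Ici.2 (le_max_right t X)), ?_⟩
        -- Moving the base point from `X` to `Y` changes the integral by a constant.
        refine (tendsto_atBot_add_const_right _ (-∫ t in X..Y, (lam j t).re) h.2).congr' ?_
        filter_upwards [eventually_ge_atTop Y] with x hx
        rw [← sub_eq_add_neg, intervalIntegral.integral_interval_sub_left
          (hint j X x le_rfl (hXY.trans hx)) (hint j X Y le_rfl hXY)]
        refine intervalIntegral.integral_congr fun t ht => ?_
        rw [uIcc_of_le hx] at ht
        simp only [hmax t (hXY.trans ht.1)])
      k hY
    refine ⟨η, fun x hx j => ?_, h2, h3⟩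
    have := h1 x hx j
    rwa [hmax x (hXY.trans hx)] at this
  by_cases hI : (Fintype.card ι : ℝ) * ∫ t in Ici X, r t < 1
  · obtain ⟨η, h1, h2, h3⟩ := main X le_rfl hI
    exact ⟨η, h1, h2, fun _ j x _ => h3 x j⟩
  · obtain ⟨Y, hXY, hY⟩ : ∃ Y, X ≤ Y ∧ (Fintype.card ι : ℝ) * ∫ t in Ici Y, r t < 1 := by
      have h := (tendsto_setIntegral_Ici_zero hr).const_mul (Fintype.card ι : ℝ)
      rw [mul_zero] at h
      exact ((eventually_ge_atTop X).and (h.eventually_lt_const one_pos)).exists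
    obtain ⟨η, h1, h2, -⟩ := main Y hXY hY
    -- The equation for `η` is inhomogeneous, but `e_k + η` solves a homogeneous one because `lam k
    -- = 0`; it is this vector that is continued backward.
    have hmul : ∀ x ∈ Ici X, ∀ v : ι → ℂ,
        (Matrix.of fun i j => (if i = j then lam i (max x X) else 0) + B i j (max x X)) *ᵥ
          (Pi.single k 1 + v) = fun j => lam j x * v j + (B j k x + ∑ l, B j l x * v l) := by
      intro x hx v
      rw [hmax x hx]
      ext j
      have e1 : ∀ l, ((if j = l then lam j x else 0) + B j l x) * ((Pi.single k 1 : ι → ℂ) l + v l)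
          = (if j = l then lam j x * ((Pi.single k 1 : ι → ℂ) l) else 0)
            + (if j = l then lam j x * v l else 0) + B j l x * (Pi.single k 1 : ι → ℂ) l
            + B j l x * v l := by
        intro l; split_ifs <;> ring
      simp only [Matrix.mulVec, dotProduct, Matrix.of_apply, Pi.add_apply, e1,
        Finset.sum_add_distrib, Finset.sum_ite_eq, Finset.mem_univ, if_true]
      have e2 : lam j x * (Pi.single k 1 : ι → ℂ) j = 0 := by
        by_cases hjk : j = k
        · rw [hjk, hk x hx, zero_mul]
        · rw [Pi.single_eq_of_ne hjk, mul_zero]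
      have e3 : ∑ l, B j l x * (Pi.single k 1 : ι → ℂ) l = B j k x := by
        simp [Pi.single_apply]
      rw [e2, e3]; ring
    obtain ⟨w, hwv, hw⟩ := exists_linear_continuation
      (A := fun x => Matrix.of fun i j => (if i = j then lam i (max x X) else 0) + B i j (max x X))
      (fun i j => by
        have h1 := continuous_comp_max (hlam i)
        have h2 := continuous_comp_max (hB i j)
        simp only [Matrix.of_apply]
        split_ifs
        · exact h1.add h2
        · exact continuous_const.add h2) hXY
      (v := fun x => Pi.single k 1 + η x) (fun x hx => by
        rw [hmul x (hXY.trans hx)]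
        exact (hasDerivWithinAt_pi.2 fun j => h1 x hx j).const_add _)
    refine ⟨fun x => w x - Pi.single k 1, fun x hx j => ?_, fun j => ?_, fun h => absurd h hI⟩
    · have h := hw x hx
      rw [show w x = Pi.single k 1 + (w x - Pi.single k 1) by abel, hmul x hx] at h
      exact hasDerivWithinAt_pi.1 (h.sub_const (Pi.single k 1)) j
    · refine (h2 j).congr' ?_
      filter_upwards [eventually_ge_atTop Y] with x hx
      rw [hwv hx]
      simp

/-! ### The logarithm and the powers of `Q` -/

theorem IsLogOn.ne_zero {X : ℝ} {Q L : ℝ → ℂ} (hL : IsLogOn X Q L) {x : ℝ} (hx : x ∈ Ici X) :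
    Q x ≠ 0 := by
  rw [← hL.2 x hx]; exact Complex.exp_ne_zero _

/-- A continuous logarithm is as smooth as the function. -/
theorem IsLogOn.contDiffOn {X : ℝ} {Q L : ℝ → ℂ} {m : WithTop ℕ∞} (hQ : ContDiffOn ℝ m Q (Ici X))
    (hL : IsLogOn X Q L) : ContDiffOn ℝ m L (Ici X) := by
  intro x₀ hx₀
  have hQ0 := hL.ne_zero hx₀
  have h1 : ContDiffWithinAt ℝ m (fun x => Complex.log (Q x / Q x₀)) (Ici X) x₀ := by
    have hlog : ContDiffAt ℝ m Complex.log (Q x₀ / Q x₀) := by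
      rw [div_self hQ0]
      exact (Complex.contDiffAt_log (n := m) Complex.one_mem_slitPlane).restrict_scalars ℝ
    exact hlog.comp_contDiffWithinAt x₀ ((hQ x₀ hx₀).div_const _)
  have h2 : ContDiffWithinAt ℝ m (fun x => Complex.log (Q x / Q x₀) + L x₀) (Ici X) x₀ :=
    h1.add contDiffWithinAt_const
  -- Near `x₀` the increment of `L` stays in the strip `|Im| < π`, where the principal logarithm
  -- inverts `exp`.
  have hev : ∀ᶠ x in 𝓝[Ici X] x₀, |(L x - L x₀).im| < Real.pi := by
    have hc : ContinuousWithinAt (fun x => |(L x - L x₀).im|) (Ici X) x₀ :=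
      (Complex.continuous_im.continuousAt.comp_continuousWithinAt
        ((hL.1 x₀ hx₀).sub continuousWithinAt_const)).abs
    exact hc.eventually_lt_const (by simp [Real.pi_pos])
  have hval : ∀ x ∈ Ici X, |(L x - L x₀).im| < Real.pi →
      L x = Complex.log (Q x / Q x₀) + L x₀ := by
    intro x hx h
    rw [← hL.2 x hx, ← hL.2 x₀ hx₀, ← Complex.exp_sub, Complex.log_exp (abs_lt.1 h).1
      (abs_lt.1 h).2.le]
    ring
  refine h2.congr_of_eventuallyEq ?_ (hval x₀ hx₀ (by simp [Real.pi_pos]))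
  filter_upwards [hev, self_mem_nhdsWithin] with x h hx
  exact hval x hx h

theorem IsLogOn.hasDerivWithinAt {X : ℝ} {Q L : ℝ → ℂ} (hQ : ContDiffOn ℝ 2 Q (Ici X))
    (hL : IsLogOn X Q L) {x : ℝ} (hx : x ∈ Ici X) :
    HasDerivWithinAt L (derivWithin Q (Ici X) x / Q x) (Ici X) x := by
  have hd : HasDerivWithinAt L (derivWithin L (Ici X) x) (Ici X) x :=
    ((hL.contDiffOn hQ).differentiableOn (by norm_num) x hx).hasDerivWithinAt
  have h1 : HasDerivWithinAt Q (Complex.exp (L x) * derivWithin L (Ici X) x) (Ici X) x :=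
    hd.cexp.congr (fun y hy => (hL.2 y hy).symm) (hL.2 x hx).symm
  rw [h1.derivWithin (uniqueDiffOn_Ici X x hx), hL.2 x hx, mul_div_cancel_left₀ _ (hL.ne_zero hx)]
  exact hd

theorem contDiffOn_qpow {X : ℝ} {L : ℝ → ℂ} {m : WithTop ℕ∞} (hL : ContDiffOn ℝ m L (Ici X))
    (s : ℂ) : ContDiffOn ℝ m (qpow L s) (Ici X) :=
  (contDiffOn_const.mul hL).cexp

theorem qpow_add (L : ℝ → ℂ) (s t : ℂ) (x : ℝ) :
    qpow L (s + t) x = qpow L s x * qpow L t x := by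
  rw [qpow, add_mul, Complex.exp_add]; rfl

theorem qpow_ne_zero (L : ℝ → ℂ) (s : ℂ) (x : ℝ) : qpow L s x ≠ 0 := Complex.exp_ne_zero _

theorem hasDerivWithinAt_qpow {X : ℝ} {Q L : ℝ → ℂ} (hQ : ContDiffOn ℝ 2 Q (Ici X))
    (hL : IsLogOn X Q L) (s : ℂ) {x : ℝ} (hx : x ∈ Ici X) :
    HasDerivWithinAt (qpow L s) (qpow L s x * (s * (derivWithin Q (Ici X) x / Q x))) (Ici X) x :=
  ((hL.hasDerivWithinAt hQ hx).const_mul s).cexp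

theorem contDiffOn_qfac {X : ℝ} {Q L : ℝ → ℂ} (n : ℕ) (hQ : ContDiffOn ℝ 2 Q (Ici X))
    (hL : IsLogOn X Q L) : ContDiffOn ℝ 1 (qfac n X Q L) (Ici X) := by
  refine (hQ.derivWithin (uniqueDiffOn_Ici X) (by norm_num)).mul ?_
  exact contDiffOn_qpow ((hL.contDiffOn hQ).of_le (by norm_num)) _

/-- `Q^{1/n}` times `Q' Q^{-1-1/n}` is `Q'/Q`. -/
theorem qroot_mul_qfac {X : ℝ} {Q L : ℝ → ℂ} (n : ℕ) (hL : IsLogOn X Q L) {x : ℝ}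
    (hx : x ∈ Ici X) : qroot n L x * qfac n X Q L x = derivWithin Q (Ici X) x / Q x := by
  have h : qpow L (1 / (n : ℂ)) x * qpow L (-1 - 1 / (n : ℂ)) x = (Q x)⁻¹ := by
    rw [← qpow_add, ← hL.2 x hx, ← Complex.exp_neg, qpow]
    congr 1; ring
  rw [qroot, qfac, mul_left_comm, h, div_eq_mul_inv]

/-! ### Regularity of the transformed systems -/

theorem contDiffOn_V1 {n : ℕ} {M : ℕ} {X : ℝ} {Q L : ℝ → ℂ}
    {S : ℕ → ℝ → Matrix (Fin n) (Fin n) ℂ}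
    (hQ : ContDiffOn ℝ 2 Q (Ici X)) (hL : IsLogOn X Q L)
    (hS : ∀ m, 2 ≤ m → m ≤ M - 1 → ∀ i j, ContDiffOn ℝ 1 (fun x => S m x i j) (Ici X))
    {m : ℕ} (hm1 : 1 ≤ m) (hm : m ≤ M - 1) (i j : Fin n) :
    ContDiffOn ℝ 1 (fun x => V1 n X Q L S m x i j) (Ici X) := by
  by_cases h1 : m = 1
  · simp only [V1, h1, if_true, R1, Matrix.smul_apply, smul_eq_mul]
    exact (contDiffOn_qfac n hQ hL).mul contDiffOn_const
  · simp only [V1, h1, if_false, Matrix.sub_apply, dg, Matrix.diagonal_apply, Matrix.diag_apply]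
    refine (hS m (by omega) hm i j).sub ?_
    split_ifs
    · exact hS m (by omega) hm i i
    · exact contDiffOn_const

theorem contDiffOn_Pmat {n : ℕ} {M : ℕ} {X : ℝ} {Q L : ℝ → ℂ}
    {S : ℕ → ℝ → Matrix (Fin n) (Fin n) ℂ}
    (hQ : ContDiffOn ℝ 2 Q (Ici X)) (hL : IsLogOn X Q L)
    (hS : ∀ m, 2 ≤ m → m ≤ M - 1 → ∀ i j, ContDiffOn ℝ 1 (fun x => S m x i j) (Ici X))
    {m : ℕ} (hm1 : 1 ≤ m) (hm : m ≤ M - 1) (i j : Fin n) :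
    ContDiffOn ℝ 1 (fun x => Pmat n X Q L S m x i j) (Ici X) := by
  simp only [Pmat, Matrix.of_apply]
  split_ifs
  · exact contDiffOn_const
  · exact (contDiffOn_V1 hQ hL hS hm1 hm i j).div_const _

theorem continuousOn_matrix {n : ℕ} {s : Set ℝ} {A : ℝ → Matrix (Fin n) (Fin n) ℂ} :
    ContinuousOn A s ↔ ∀ i j, ContinuousOn (fun x => A x i j) s :=
  continuousOn_pi.trans (forall_congr' fun _ => continuousOn_pi)

theorem continuousOn_matrix_inv {n : ℕ} {s : Set ℝ} {A : ℝ → Matrix (Fin n) (Fin n) ℂ}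
    (hA : ContinuousOn A s) (hu : ∀ x ∈ s, IsUnit (A x)) : ContinuousOn (fun x => (A x)⁻¹) s := by
  have hdet : ContinuousOn (fun x => (A x).det) s :=
    (Continuous.matrix_det continuous_id).comp_continuousOn hA
  have hadj : ContinuousOn (fun x => (A x).adjugate) s :=
    (Continuous.matrix_adjugate continuous_id).comp_continuousOn hA
  have h0 : ∀ x ∈ s, (A x).det ≠ 0 := fun x hx =>
    ((Matrix.isUnit_iff_isUnit_det _).1 (hu x hx)).ne_zero
  simp only [Matrix.inv_def, Ring.inverse_eq_inv']
  exact (hdet.inv₀ h0).smul hadj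

theorem continuousOn_dg {n : ℕ} {s : Set ℝ} {A : ℝ → Matrix (Fin n) (Fin n) ℂ}
    (hA : ContinuousOn A s) : ContinuousOn (fun x => dg (A x)) s :=
  ((continuous_id.matrix_diag).matrix_diagonal).comp_continuousOn hA

section

variable {n M : ℕ} {X : ℝ} {Q L : ℝ → ℂ} {S : ℕ → ℝ → Matrix (Fin n) (Fin n) ℂ}

theorem continuousOn_S
    (hS : ∀ m, 2 ≤ m → m ≤ M - 1 → ∀ i j, ContDiffOn ℝ 1 (fun x => S m x i j) (Ici X))
    (hSM : ∀ i j, ContinuousOn (fun x => S M x i j) (Ici X)) {m : ℕ} (hm2 : 2 ≤ m) (hm : m ≤ M) :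
    ContinuousOn (S m) (Ici X) := by
  refine continuousOn_matrix.2 fun i j => ?_
  by_cases h : m = M
  · rw [h]; exact hSM i j
  · exact (hS m hm2 (by omega) i j).continuousOn

theorem continuousOn_delta
    (hS : ∀ m, 2 ≤ m → m ≤ M - 1 → ∀ i j, ContDiffOn ℝ 1 (fun x => S m x i j) (Ici X))
    (hSM : ∀ i j, ContinuousOn (fun x => S M x i j) (Ici X)) {m : ℕ} (hm : m ≤ M) (j : Fin n) :
    ContinuousOn (delta S m j) (Ici X) := by
  refine continuousOn_finsetSum _ fun i hi => ?_
  rw [Finset.mem_Icc] at hi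
  exact continuousOn_matrix.1 (continuousOn_S hS hSM hi.1 (hi.2.trans hm)) j j

/-- Each stage differentiates `P_m` but not `R_m`, and `S_M` enters `R_M` only through its diagonal;
hence `C^1` selections before stage `M` and a continuous `S_M` suffice. -/
theorem continuousOn_Rmat (hQ : ContDiffOn ℝ 2 Q (Ici X)) (hL : IsLogOn X Q L)
    (hS : ∀ m, 2 ≤ m → m ≤ M - 1 → ∀ i j, ContDiffOn ℝ 1 (fun x => S m x i j) (Ici X))
    (hSM : ∀ i j, ContinuousOn (fun x => S M x i j) (Ici X))
    (hP : ∀ m, 1 ≤ m → m ≤ M - 1 → ∀ x ∈ Ici X, IsUnit (1 + Pmat n X Q L S m x)) :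
    ∀ m, m ≤ M → ContinuousOn (Rmat n X Q L S m) (Ici X)
  | 0, _ => continuousOn_const
  | 1, _ => by
    exact (contDiffOn_qfac n hQ hL).continuousOn.smul continuousOn_const
  | m + 2, hm => by
    have hP' : ContinuousOn (Pmat n X Q L S (m + 1)) (Ici X) := continuousOn_matrix.2 fun i j =>
      (contDiffOn_Pmat hQ hL hS (by omega) (by omega) i j).continuousOn
    have hV : ContinuousOn (V1 n X Q L S (m + 1)) (Ici X) := continuousOn_matrix.2 fun i j =>
      (contDiffOn_V1 hQ hL hS (by omega) (by omega) i j).continuousOn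
    have hd : ContinuousOn (matDeriv X (Pmat n X Q L S (m + 1))) (Ici X) :=
      continuousOn_matrix.2 fun i j =>
        (contDiffOn_Pmat hQ hL hS (by omega) (by omega) i j).continuousOn_derivWithin
          (uniqueDiffOn_Ici X) le_rfl
    have hq : ContinuousOn (fun x => (qroot n L x)⁻¹) (Ici X) :=
      (contDiffOn_qpow (hL.contDiffOn hQ) _).continuousOn.inv₀ fun x _ => qpow_ne_zero _ _ _
    have hΔ : ContinuousOn (Delta S (m + 1)) (Ici X) :=
      (continuous_id.matrix_diagonal).comp_continuousOn
        (continuousOn_pi.2 fun j => continuousOn_delta hS hSM (by omega) j)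
    have h1P : ContinuousOn (fun x => 1 + Pmat n X Q L S (m + 1) x) (Ici X) :=
      continuousOn_const.add hP'
    have hinv := continuousOn_matrix_inv h1P (hP (m + 1) (by omega) (by omega))
    have hR := continuousOn_Rmat hQ hL hS hSM hP (m + 1) (by omega)
    have hT : ContinuousOn (Tmat n X Q L S (m + 1)) (Ici X) := (hΔ.mul hP').sub (hP'.mul hΔ)
    exact (hinv.mul ((((hq.smul hd).neg.add hT).add (hV.mul hP')).add
      ((hR.sub hV).mul h1P))).sub (continuousOn_dg (continuousOn_S hS hSM (by omega) hm))

end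

/-! ### Roots of unity and the matrices `Ω`, `C` -/

theorem omega_eq_pow (n : ℕ) (k : Fin n) :
    omega n k = Complex.exp (2 * Real.pi * Complex.I / n) ^ (k : ℕ) := by
  rw [omega, ← Complex.exp_nat_mul]
  congr 1; ring

theorem omega_ne_zero (n : ℕ) (k : Fin n) : omega n k ≠ 0 := Complex.exp_ne_zero _

theorem omega_pow_self (n : ℕ) (k : Fin n) : omega n k ^ n = 1 := by
  have hn : n ≠ 0 := (Fin.pos k).ne'
  rw [omega_eq_pow, ← pow_mul, mul_comm (k : ℕ) n, pow_mul, (Complex.isPrimitiveRoot_exp n hn).pow_eq_one,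
    one_pow]

theorem omega_injective (n : ℕ) : Function.Injective (omega n) := by
  intro j k h
  rw [omega_eq_pow, omega_eq_pow] at h
  exact Fin.ext ((Complex.isPrimitiveRoot_exp n (Fin.pos k).ne').pow_inj j.2 k.2 h)

/-- Orthogonality of characters: the geometric sum of `ζ^j / ζ^k` over a full period vanishes unless
`j = k`. -/
theorem Omega_mul_OmegaInv (n : ℕ) : Omega n * OmegaInv n = 1 := by
  ext j k
  have hn : n ≠ 0 := (Fin.pos k).ne'
  have hn' : (n : ℂ) ≠ 0 := Nat.cast_ne_zero.2 hn
  have hζ := Complex.isPrimitiveRoot_exp n hn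
  set ζ := Complex.exp (2 * Real.pi * Complex.I / n) with hζdef
  have e : ∀ l : Fin n, omega n l ^ (j : ℕ) * ((n : ℂ)⁻¹ * (omega n l ^ (k : ℕ))⁻¹)
      = (n : ℂ)⁻¹ * (ζ ^ (j : ℕ) / ζ ^ (k : ℕ)) ^ (l : ℕ) := by
    intro l
    rw [omega_eq_pow, ← hζdef, div_pow, ← pow_mul, ← pow_mul, ← pow_mul, ← pow_mul,
      mul_comm (l : ℕ) j, mul_comm (l : ℕ) k, div_eq_mul_inv]
    ring
  simp only [Matrix.mul_apply, Omega, OmegaInv, Matrix.of_apply, e]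
  rw [← Finset.mul_sum, Fin.sum_univ_eq_sum_range (fun l => (ζ ^ (j : ℕ) / ζ ^ (k : ℕ)) ^ l) n]
  have hζ0 : ζ ≠ 0 := Complex.exp_ne_zero _
  by_cases hjk : j = k
  · subst hjk
    rw [div_self (pow_ne_zero _ hζ0), Matrix.one_apply_eq]
    simp [hn']
  · rw [Matrix.one_apply_ne hjk]
    have h1 : ζ ^ (j : ℕ) / ζ ^ (k : ℕ) ≠ 1 := by
      rw [Ne, div_eq_one_iff_eq (pow_ne_zero _ hζ0)]
      exact fun h => hjk (Fin.ext (hζ.pow_inj j.2 k.2 h))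
    have h2 : (ζ ^ (j : ℕ) / ζ ^ (k : ℕ)) ^ n = 1 := by
      rw [div_pow, ← pow_mul, ← pow_mul, mul_comm (j : ℕ), mul_comm (k : ℕ), pow_mul, pow_mul,
        hζ.pow_eq_one, one_pow, one_pow, div_one]
    rw [geom_sum_eq h1, h2, sub_self, zero_div, mul_zero]

/-- On the diagonal the powers of `ω_j` cancel, leaving `-n⁻² (0 + 1 + ⋯ + (n-1))`. This is the
source of the scalar term in `Dmat`. -/
theorem dg_Cmat (n : ℕ) :
    dg (Cmat n) = -(((n : ℂ) - 1) * (2 * (n : ℂ))⁻¹) • (1 : Matrix (Fin n) (Fin n) ℂ) := by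
  rw [dg, ← Matrix.diagonal_one, ← Matrix.diagonal_smul]
  congr 1
  ext j
  have hn : n ≠ 0 := (Fin.pos j).ne'
  have hn' : (n : ℂ) ≠ 0 := Nat.cast_ne_zero.2 hn
  have hs : (∑ l ∈ Finset.range n, (l : ℂ)) * 2 = n * (n - 1) := by
    have h := Finset.sum_range_id_mul_two n
    have h' := congrArg (Nat.cast : ℕ → ℂ) h
    push_cast [Nat.cast_sub (Nat.one_le_iff_ne_zero.2 hn)] at h'
    exact h'
  have e : ∀ l : Fin n, (n : ℂ)⁻¹ * (omega n j ^ (l : ℕ))⁻¹ * ((n : ℂ)⁻¹ * ((l : ℕ) : ℂ))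
      * omega n j ^ (l : ℕ) = (n : ℂ)⁻¹ * (n : ℂ)⁻¹ * ((l : ℕ) : ℂ) := by
    intro l
    have := pow_ne_zero (l : ℕ) (omega_ne_zero n j)
    field_simp
  simp only [Matrix.diag_apply, Cmat, Matrix.neg_apply, Matrix.mul_apply (M := _ * _),
    Matrix.mul_diagonal, OmegaInv, Omega, Matrix.of_apply, e, Pi.smul_apply, smul_eq_mul, mul_one]
  rw [← Finset.mul_sum, Fin.sum_univ_eq_sum_range (fun l => (l : ℂ)) n]
  have : ∑ l ∈ Finset.range n, (l : ℂ) = n * (n - 1) / 2 := by rw [← hs]; ring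
  rw [this]
  field_simp

/-- Row `r` supplies the term that cancels `(r/n) Q'/Q`, which arises from differentiating
`Q^{r/n}`. -/
theorem Omega_mul_Cmat (n : ℕ) : Omega n * Cmat n =
    -(Matrix.diagonal (fun j : Fin n => (n : ℂ)⁻¹ * ((j : ℕ) : ℂ)) * Omega n) := by
  rw [Cmat, Matrix.mul_neg, ← Matrix.mul_assoc, ← Matrix.mul_assoc, Omega_mul_OmegaInv,
    Matrix.one_mul]

theorem hasDerivWithinAt_mulVec {n : ℕ} {A : ℝ → Matrix (Fin n) (Fin n) ℂ}
    {A' : Matrix (Fin n) (Fin n) ℂ} {v : ℝ → Fin n → ℂ} {v' : Fin n → ℂ} {s : Set ℝ} {x : ℝ}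
    (hA : ∀ i j, HasDerivWithinAt (fun t => A t i j) (A' i j) s x)
    (hv : HasDerivWithinAt v v' s x) :
    HasDerivWithinAt (fun t => A t *ᵥ v t) (A' *ᵥ v x + A x *ᵥ v') s x := by
  refine hasDerivWithinAt_pi.2 fun i => ?_
  have h := HasDerivWithinAt.fun_sum (u := Finset.univ) fun j _ =>
    (hA i j).mul (hasDerivWithinAt_pi.1 hv j)
  refine h.congr_deriv ?_
  simp only [Pi.add_apply, Matrix.mulVec, dotProduct, Finset.sum_add_distrib]

/-! ### The transformations `Z_m = (I + P_m) Z_{m+1}` -/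

section

variable {n M : ℕ} {X : ℝ} {Q L : ℝ → ℂ} {S : ℕ → ℝ → Matrix (Fin n) (Fin n) ℂ}

/-- The commutator with `D` multiplies entry `(i, j)` by `ω_j - ω_i`, which is nonzero off the
diagonal because the roots are distinct. -/
theorem diagonal_omega_mul_Pmat (m : ℕ) (x : ℝ) (hV : ∀ i, V1 n X Q L S m x i i = 0) :
    Pmat n X Q L S m x * Matrix.diagonal (omega n) - Matrix.diagonal (omega n) * Pmat n X Q L S m x
      = V1 n X Q L S m x := by
  ext i j
  rw [Matrix.sub_apply, Matrix.mul_diagonal, Matrix.diagonal_mul, Pmat, Matrix.of_apply]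
  by_cases h : i = j
  · subst h; simp [hV]
  · have : omega n j - omega n i ≠ 0 := sub_ne_zero.2 fun h' => h (omega_injective n h').symm
    rw [if_neg h]
    field_simp

theorem V1_diag (m : ℕ) (x : ℝ) (i : Fin n) : V1 n X Q L S m x i i = 0 := by
  unfold V1
  split_ifs <;> simp [R1, dg]

theorem Dmat_succ {m : ℕ} (hm : 1 ≤ m) (x : ℝ) :
    Dmat n X Q L S (m + 1) x = Dmat n X Q L S m x + dg (S (m + 1) x) := by
  have : Delta S (m + 1) x = Delta S m x + dg (S (m + 1) x) := by
    rw [Delta, Delta, dg, Matrix.diagonal_add]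
    congr 1
    ext j
    rw [delta, Finset.sum_Icc_succ_top (by omega)]
    rfl
  rw [Dmat, this, Dmat]; abel

/-- The algebra behind `Z_m = (I + P_m) Z_{m+1}`. -/
theorem matDeriv_add_mul {m : ℕ} (hm : 1 ≤ m) (x : ℝ)
    (hP : IsUnit (1 + Pmat n X Q L S m x)) :
    matDeriv X (Pmat n X Q L S m) x + qroot n L x • ((1 + Pmat n X Q L S m x) *
        (Dmat n X Q L S (m + 1) x + Rmat n X Q L S (m + 1) x))
      = qroot n L x • ((Dmat n X Q L S m x + Rmat n X Q L S m x) * (1 + Pmat n X Q L S m x)) := by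
  obtain ⟨m, rfl⟩ : ∃ l, m = l + 1 := ⟨m - 1, by omega⟩
  have hq : qroot n L x ≠ 0 := qpow_ne_zero _ _ _
  have hdet := (Matrix.isUnit_iff_isUnit_det _).1 hP
  have hcomm := diagonal_omega_mul_Pmat (n := n) (X := X) (Q := Q) (L := L) (S := S) (m + 1) x
    (V1_diag (m + 1) x)
  rw [Dmat_succ hm, Rmat]
  set P := Pmat n X Q L S (m + 1) x
  set V := V1 n X Q L S (m + 1) x
  set R := Rmat n X Q L S (m + 1) x
  set P' := matDeriv X (Pmat n X Q L S (m + 1)) x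
  set W := -((qroot n L x)⁻¹ • P') + Tmat n X Q L S (m + 1) x + V * P + (R - V) * (1 + P) with hW
  have h1 : (1 + P) * (Dmat n X Q L S (m + 1) x + dg (S (m + 2) x)
      + ((1 + P)⁻¹ * W - dg (S (m + 2) x))) = (1 + P) * Dmat n X Q L S (m + 1) x + W := by
    rw [add_assoc, add_sub_cancel, Matrix.mul_add, Matrix.mul_nonsing_inv_cancel_left _ _ hdet]
  have h2 : P' = qroot n L x • ((qroot n L x)⁻¹ • P') := by
    rw [smul_smul, mul_inv_cancel₀ hq, one_smul]
  rw [h1, h2, ← smul_add]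
  congr 1
  -- The scalar part of `D_m` commutes with `P`; the constant part gives `V` and `Δ_m` gives `-T_m`.
  have h3 : P * Dmat n X Q L S (m + 1) x - Dmat n X Q L S (m + 1) x * P
      = V - Tmat n X Q L S (m + 1) x := by
    rw [← hcomm, Tmat, Dmat]
    simp only [Matrix.mul_add, Matrix.add_mul, Matrix.mul_sub, Matrix.sub_mul, Matrix.mul_smul,
      Matrix.smul_mul, Matrix.mul_one, Matrix.one_mul]
    abel
  have h4 : P * Dmat n X Q L S (m + 1) x = Dmat n X Q L S (m + 1) x * P + (V
      - Tmat n X Q L S (m + 1) x) := by rw [← h3]; abel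
  rw [hW, Matrix.add_mul, Matrix.one_mul, h4]
  simp only [Matrix.mul_add, Matrix.add_mul, Matrix.sub_mul, Matrix.mul_one]
  abel

/-- `Z' = Q^{1/n} (D_m + R_m) Z` on `[X, ∞)`. -/
def IsSystemSolution (n : ℕ) (X : ℝ) (Q L : ℝ → ℂ) (S : ℕ → ℝ → Matrix (Fin n) (Fin n) ℂ) (m : ℕ)
    (Z : ℝ → Fin n → ℂ) : Prop :=
  ∀ x ∈ Ici X, HasDerivWithinAt Z
    (qroot n L x • ((Dmat n X Q L S m x + Rmat n X Q L S m x) *ᵥ Z x)) (Ici X) x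

theorem IsSystemSolution.of_succ {m : ℕ} (hm : 1 ≤ m)
    (hPd : ∀ i j, ContDiffOn ℝ 1 (fun x => Pmat n X Q L S m x i j) (Ici X))
    (hP : ∀ x ∈ Ici X, IsUnit (1 + Pmat n X Q L S m x)) {Z : ℝ → Fin n → ℂ}
    (hZ : IsSystemSolution n X Q L S (m + 1) Z) :
    IsSystemSolution n X Q L S m fun x => (1 + Pmat n X Q L S m x) *ᵥ Z x := by
  intro x hx
  have hA : ∀ i j, HasDerivWithinAt (fun t => (1 + Pmat n X Q L S m t) i j)
      (matDeriv X (Pmat n X Q L S m) x i j) (Ici X) x := fun i j =>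
    (((hPd i j).differentiableOn (by norm_num)) x hx).hasDerivWithinAt.const_add _
  refine (hasDerivWithinAt_mulVec hA (hZ x hx)).congr_deriv ?_
  rw [Matrix.mulVec_smul, Matrix.mulVec_mulVec, Matrix.mulVec_mulVec, ← Matrix.smul_mulVec,
    ← Matrix.add_mulVec, matDeriv_add_mul hm x (hP x hx), Matrix.smul_mulVec]

/-- The factor of highest index acts first, so the induction peels factors off the right end of the
product. -/
theorem IsSystemSolution.to_first
    (hPd : ∀ m, 1 ≤ m → m ≤ M - 1 → ∀ i j,
      ContDiffOn ℝ 1 (fun x => Pmat n X Q L S m x i j) (Ici X))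
    (hP : ∀ m, 1 ≤ m → m ≤ M - 1 → ∀ x ∈ Ici X, IsUnit (1 + Pmat n X Q L S m x)) :
    ∀ N, N ≤ M - 1 → ∀ Z, IsSystemSolution n X Q L S (N + 1) Z →
      IsSystemSolution n X Q L S 1 fun x =>
        ((List.range N).map fun m => 1 + Pmat n X Q L S (m + 1) x).prod *ᵥ Z x := by
  intro N
  induction N with
  | zero => intro _ Z hZ; simpa using hZ
  | succ N ih =>
    intro hN Z hZ
    have h := ih (by omega) _ (hZ.of_succ (by omega) (hPd _ (by omega) hN) (hP _ (by omega) hN))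
    simpa [List.range_succ, Matrix.mulVec_mulVec] using h

/-! ### Return to the scalar equation -/

/-- The diagonal of `C`, removed from `R_1`, is exactly the scalar term of `D_1`, so stage `1` is
the untransformed system. -/
theorem Dmat_one_add_Rmat_one (x : ℝ) : Dmat n X Q L S 1 x + Rmat n X Q L S 1 x =
    Matrix.diagonal (omega n) + qfac n X Q L x • Cmat n := by
  have : Delta S 1 x = 0 := by
    rw [Delta]
    simp [delta]
  rw [Dmat, Rmat, R1, dg_Cmat, this]
  ext i j
  simp
  ring

/-- The derivatives `y^{(r)} = Q^{r/n} ∑ ω_j^r Z_j` in terms of `Z`. -/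
theorem IsSystemSolution.hasDerivWithinAt_sum (hQ : ContDiffOn ℝ 2 Q (Ici X))
    (hL : IsLogOn X Q L) {Z : ℝ → Fin n → ℂ} (hZ : IsSystemSolution n X Q L S 1 Z) {r : ℕ}
    (hr : r < n) {x : ℝ} (hx : x ∈ Ici X) :
    HasDerivWithinAt (fun x => qpow L (r / n) x * ∑ j, omega n j ^ r * Z x j)
      (qpow L ((r + 1 : ℕ) / n) x * ∑ j, omega n j ^ (r + 1) * Z x j) (Ici X) x := by
  have hZ' := hasDerivWithinAt_pi.1 (hZ x hx)
  have h := (hasDerivWithinAt_qpow hQ hL (r / n) hx).mul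
    (HasDerivWithinAt.fun_sum (u := Finset.univ) fun j _ => (hZ' j).const_mul (omega n j ^ r))
  refine h.congr_deriv ?_
  have hC : ∑ j, omega n j ^ r * (Cmat n *ᵥ Z x) j = -(r / n * ∑ j, omega n j ^ r * Z x j) := by
    have h1 : (Omega n *ᵥ (Cmat n *ᵥ Z x)) ⟨r, hr⟩ = ∑ j, omega n j ^ r * (Cmat n *ᵥ Z x) j := rfl
    rw [← h1, Matrix.mulVec_mulVec, Omega_mul_Cmat, Matrix.neg_mulVec, ← Matrix.mulVec_mulVec,
      Pi.neg_apply, Matrix.mulVec_diagonal]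
    have h2 : (Omega n *ᵥ Z x) ⟨r, hr⟩ = ∑ j, omega n j ^ r * Z x j := rfl
    rw [h2]
    congr 1
    rw [div_eq_inv_mul]
  have e : ∀ j, omega n j ^ r * (qroot n L x •
      ((Dmat n X Q L S 1 x + Rmat n X Q L S 1 x) *ᵥ Z x)) j
      = qroot n L x * (omega n j ^ (r + 1) * Z x j)
        + derivWithin Q (Ici X) x / Q x * (omega n j ^ r * (Cmat n *ᵥ Z x) j) := by
    intro j
    rw [Dmat_one_add_Rmat_one, Matrix.add_mulVec, Matrix.smul_mulVec, ← qroot_mul_qfac n hL hx]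
    simp only [Pi.smul_apply, Pi.add_apply, smul_eq_mul, Matrix.mulVec_diagonal]
    ring
  simp only [e, Finset.sum_add_distrib, ← Finset.mul_sum, hC]
  have hq : qpow L ((r + 1 : ℕ) / n) x = qpow L (r / n) x * qroot n L x := by
    rw [qroot, ← qpow_add]
    congr 1; push_cast; ring
  rw [hq]; ring

end

theorem iteratedDerivWithin_eqOn {n : ℕ} {s : Set ℝ} (hs : UniqueDiffOn ℝ s) {Y : ℕ → ℝ → ℂ}
    (hY : ∀ r < n, ∀ x ∈ s, HasDerivWithinAt (Y r) (Y (r + 1) x) s x) :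
    ∀ r ≤ n, EqOn (iteratedDerivWithin r (Y 0) s) (Y r) s := by
  intro r
  induction r with
  | zero => intro _ x _; simp
  | succ r ih =>
    intro hr x hx
    have h := ih (by omega)
    rw [iteratedDerivWithin_succ, derivWithin_congr h (h hx)]
    exact (hY r (by omega) x hx).derivWithin (hs x hx)

theorem contDiffOn_of_hasDerivWithinAt {n : ℕ} {s : Set ℝ} (hs : UniqueDiffOn ℝ s)
    {Y : ℕ → ℝ → ℂ} (hY : ∀ r < n, ∀ x ∈ s, HasDerivWithinAt (Y r) (Y (r + 1) x) s x)
    (hc : ContinuousOn (Y n) s) : ContDiffOn ℝ n (Y 0) s := by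
  have heq := iteratedDerivWithin_eqOn hs hY
  refine (contDiffOn_nat_iff_continuousOn_differentiableOn_deriv hs).2 ⟨fun m hm => ?_,
    fun m hm => ?_⟩
  · refine ContinuousOn.congr ?_ (heq m hm)
    rcases hm.lt_or_eq with h | h
    · exact fun x hx => (hY m h x hx).continuousWithinAt
    · rw [h]; exact hc
  · exact DifferentiableOn.congr (fun x hx => (hY m hm x hx).differentiableWithinAt)
      (heq m hm.le)

/-! ### Entry norm and solutions of the last system -/

theorem norm_le_entryMax {n : ℕ} (A : Matrix (Fin n) (Fin n) ℂ) (i j : Fin n) :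
    ‖A i j‖ ≤ entryMax A :=
  le_ciSup (f := fun p : Fin n × Fin n => ‖A p.1 p.2‖) (Set.finite_range _).bddAbove (i, j)

theorem continuous_entryMax {n : ℕ} (k : Fin n) :
    Continuous (entryMax : Matrix (Fin n) (Fin n) ℂ → ℝ) := by
  have : Nonempty (Fin n × Fin n) := ⟨(k, k)⟩
  have h : (entryMax : Matrix (Fin n) (Fin n) ℂ → ℝ) = fun A =>
      (Finset.univ : Finset (Fin n × Fin n)).sup' Finset.univ_nonempty
        fun p => ‖A p.1 p.2‖ := by
    ext A
    rw [Finset.sup'_univ_eq_ciSup]; rfl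
  rw [h]
  exact Continuous.finset_sup'_apply _ fun p _ => (continuous_id.matrix_elem p.1 p.2).norm

theorem entryMax_le_sum {n : ℕ} (k : Fin n) (A : Matrix (Fin n) (Fin n) ℂ) :
    entryMax A ≤ ∑ i, ∑ j, ‖A i j‖ := by
  have : Nonempty (Fin n × Fin n) := ⟨(k, k)⟩
  refine ciSup_le fun p => ?_
  refine (Finset.single_le_sum (f := fun j => ‖A p.1 j‖) (fun j _ => norm_nonneg _)
    (Finset.mem_univ p.2)).trans ?_
  exact Finset.single_le_sum (f := fun i => ∑ j, ‖A i j‖)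
    (fun i _ => Finset.sum_nonneg fun j _ => norm_nonneg _) (Finset.mem_univ p.1)

theorem hasDerivWithinAt_integral_Ici {f : ℝ → ℂ} {X : ℝ} (hf : ContinuousOn f (Ici X)) {x : ℝ}
    (hx : x ∈ Ici X) : HasDerivWithinAt (fun u => ∫ t in X..u, f t) (f x) (Ici X) x := by
  have key : ∀ u ∈ Ici X, ∫ t in X..u, f t = ∫ t in X..u, f (max t X) := fun u hu =>
    intervalIntegral.integral_congr fun t ht => by
      rw [uIcc_of_le hu] at ht
      simp only [max_eq_left ht.1]
  have h := (hasDerivAt_integral_of_continuous (continuous_comp_max hf) X x).hasDerivWithinAt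
    (s := Ici X)
  rw [max_eq_left hx] at h
  exact h.congr key (key x hx)

section

variable {n M : ℕ} {X : ℝ} {Q L : ℝ → ℂ} {S : ℕ → ℝ → Matrix (Fin n) (Fin n) ℂ}

theorem integrableOn_qroot_mul_entryMax (k : Fin n)
    (hq : ContinuousOn (qroot n L) (Ici X)) (hR : ContinuousOn (Rmat n X Q L S M) (Ici X))
    (hint : ∀ i j : Fin n, IntegrableOn (fun t => qroot n L t * Rmat n X Q L S M t i j) (Ici X)) :
    IntegrableOn (fun t => ‖qroot n L t‖ * entryMax (Rmat n X Q L S M t)) (Ici X) := by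
  have hsum : IntegrableOn (fun t => ∑ i, ∑ j, ‖qroot n L t * Rmat n X Q L S M t i j‖) (Ici X) :=
    integrable_finsetSum _ fun i _ => integrable_finsetSum _ fun j _ => (hint i j).norm
  refine hsum.mono' ?_ (Eventually.of_forall fun t => ?_)
  · exact (hq.norm.mul ((continuous_entryMax k).comp_continuousOn hR)).aestronglyMeasurable
      measurableSet_Ici
  · have h0 : 0 ≤ entryMax (Rmat n X Q L S M t) := (norm_nonneg _).trans (norm_le_entryMax _ k k)
    rw [Real.norm_of_nonneg (mul_nonneg (norm_nonneg _) h0)]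
    simp only [norm_mul, ← Finset.mul_sum]
    exact mul_le_mul_of_nonneg_left (entryMax_le_sum k _) (norm_nonneg _)

/-- For a continuous function of constant sign with `|∫| → ∞`, the integral tends to `-∞` if the
function is nonpositive. -/
theorem tendsto_integral_atBot {f : ℝ → ℝ} (hf : ∀ x ∈ Ici X, f x ≤ 0)
    (h : Tendsto (fun x => |∫ t in X..x, f t|) atTop atTop) :
    Tendsto (fun x => ∫ t in X..x, f t) atTop atBot := by
  refine (tendsto_neg_atTop_atBot.comp h).congr' ?_
  filter_upwards [eventually_ge_atTop X] with x hx
  have : ∫ t in X..x, f t ≤ 0 := by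
    have := intervalIntegral.integral_nonneg (μ := volume) hx (f := fun t => -f t)
      fun t ht => neg_nonneg.2 (hf t ht.1)
    rw [intervalIntegral.integral_neg] at this
    linarith
  simp [abs_of_nonpos this]

/-- The solution of the last system that belongs to `e_k + η`, where `η` solves the reduced
system. -/
theorem isSystemSolution_of_reduced (hQ : ContDiffOn ℝ 2 Q (Ici X)) (hL : IsLogOn X Q L)
    (k : Fin n)
    (hc : ContinuousOn (fun t => qroot n L t * (omega n k + delta S M k t)) (Ici X))
    {η : ℝ → Fin n → ℂ}
    (hη : ∀ x ∈ Ici X, ∀ j, HasDerivWithinAt (fun u => η u j)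
      ((omega n j - omega n k + delta S M j x - delta S M k x) * qroot n L x * η x j
        + (qroot n L x * Rmat n X Q L S M x j k
          + ∑ l, qroot n L x * Rmat n X Q L S M x j l * η x l)) (Ici X) x) :
    IsSystemSolution n X Q L S M fun x j =>
      qpow L (-(((n : ℂ) - 1) / (2 * n))) x *
        Complex.exp (∫ t in X..x, qroot n L t * (omega n k + delta S M k t)) *
        ((Pi.single k 1 : Fin n → ℂ) j + η x j) := by
  intro x hx
  refine hasDerivWithinAt_pi.2 fun j => ?_
  -- This power of `Q` accounts for the scalar term of `Dmat`, since `Q^{1/n} · Q' Q^{-1-1/n} =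
  -- Q'/Q`.
  have h1 := hasDerivWithinAt_qpow hQ hL (-(((n : ℂ) - 1) / (2 * n))) hx
  have h2 := (hasDerivWithinAt_integral_Ici hc hx).cexp
  have h3 := (hη x hx j).const_add ((Pi.single k 1 : Fin n → ℂ) j)
  refine ((h1.fun_mul h2).fun_mul h3).congr_deriv ?_
  set p := qpow L (-(((n : ℂ) - 1) / (2 * n))) x
  set e := Complex.exp (∫ t in X..x, qroot n L t * (omega n k + delta S M k t))
  have hmul : ((Dmat n X Q L S M x + Rmat n X Q L S M x) *ᵥ
      fun j => p * e * ((Pi.single k 1 : Fin n → ℂ) j + η x j)) j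
      = p * e * ((omega n j - ((n : ℂ) - 1) * (2 * (n : ℂ))⁻¹ * qfac n X Q L x + delta S M j x)
          * ((Pi.single k 1 : Fin n → ℂ) j + η x j)
          + (Rmat n X Q L S M x j k + ∑ l, Rmat n X Q L S M x j l * η x l)) := by
    have hD : Dmat n X Q L S M x = Matrix.diagonal fun j =>
        omega n j - ((n : ℂ) - 1) * (2 * (n : ℂ))⁻¹ * qfac n X Q L x + delta S M j x := by
      rw [Dmat, Delta, Matrix.smul_one_eq_diagonal, Matrix.diagonal_sub, Matrix.diagonal_add]
    have hR : (Rmat n X Q L S M x *ᵥ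
        fun j => p * e * ((Pi.single k 1 : Fin n → ℂ) j + η x j)) j
        = p * e * (Rmat n X Q L S M x j k + ∑ l, Rmat n X Q L S M x j l * η x l) := by
      have e1 : (fun j => p * e * ((Pi.single k 1 : Fin n → ℂ) j + η x j))
          = (p * e) • (Pi.single k 1 + η x) := rfl
      rw [e1, Matrix.mulVec_smul, Matrix.mulVec_add, Matrix.mulVec_single_one]
      rfl
    rw [Matrix.add_mulVec, Pi.add_apply, hR, hD, Matrix.mulVec_diagonal]
    ring
  -- The vector `e_k` is supported at `j = k`, so on it the diagonal part acts as the exponential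
  -- rate already factored out.
  have hsingle : (omega n j + delta S M j x) * (Pi.single k 1 : Fin n → ℂ) j
      = (omega n k + delta S M k x) * (Pi.single k 1 : Fin n → ℂ) j := by
    by_cases hjk : j = k
    · rw [hjk]
    · rw [Pi.single_eq_of_ne hjk, mul_zero, mul_zero]
  have hsum : ∑ l, qroot n L x * Rmat n X Q L S M x j l * η x l
      = qroot n L x * ∑ l, Rmat n X Q L S M x j l * η x l := by
    rw [Finset.mul_sum]
    exact Finset.sum_congr rfl fun l _ => mul_assoc _ _ _
  rw [Pi.smul_apply, smul_eq_mul, hmul, hsum, ← qroot_mul_qfac n hL hx, div_eq_mul_inv]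
  linear_combination (-(p * e * qroot n L x)) * hsingle

theorem Ptot_mulVec (k : Fin n) (x : ℝ) (c : ℂ) (v : Fin n → ℂ) (j : Fin n) :
    (((List.range (M - 1)).map fun m => 1 + Pmat n X Q L S (m + 1) x).prod *ᵥ
      fun i => c * ((Pi.single k 1 : Fin n → ℂ) i + v i)) j
      = c * ((Pi.single k 1 : Fin n → ℂ) j + (v j + Ptot n X Q L S M x j k
        + ∑ l, Ptot n X Q L S M x j l * v l)) := by
  have h1 : ((List.range (M - 1)).map fun m => 1 + Pmat n X Q L S (m + 1) x).prod
      = 1 + Ptot n X Q L S M x := by rw [Ptot]; abel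
  have h2 : (fun i => c * ((Pi.single k 1 : Fin n → ℂ) i + v i)) = c • (Pi.single k 1 + v) := rfl
  have h3 : ∑ l, Ptot n X Q L S M x j l * v l = (Ptot n X Q L S M x *ᵥ v) j := rfl
  rw [h1, h2, h3, Matrix.mulVec_smul, Matrix.add_mulVec, Matrix.one_mulVec, Matrix.mulVec_add,
    Matrix.mulVec_single_one]
  simp only [Pi.smul_apply, Pi.add_apply, smul_eq_mul, Matrix.col_apply]
  ring

/-- The chain `Q^{r/n} ∑ ω_j^r Z_j` of successive derivatives closes up at `r = n`, because `ω_j^n =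
1` and `Q^{n/n} = Q`. -/
theorem IsSystemSolution.isSolution (hn : 1 ≤ n) (hQ : ContDiffOn ℝ 2 Q (Ici X))
    (hL : IsLogOn X Q L) {Z : ℝ → Fin n → ℂ} (hZ : IsSystemSolution n X Q L S 1 Z) :
    IsSolution n X Q (fun x => ∑ j, Z x j) ∧ ∀ r ≤ n, ∀ x ∈ Ici X,
      iteratedDerivWithin r (fun x => ∑ j, Z x j) (Ici X) x
        = qpow L (r / n) x * ∑ j, omega n j ^ r * Z x j := by
  set Y : ℕ → ℝ → ℂ := fun r x => qpow L (r / n) x * ∑ j, omega n j ^ r * Z x j with hYdef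
  have hY0 : Y 0 = fun x => ∑ j, Z x j := by
    ext x; simp [hYdef, qpow]
  have hYd : ∀ r < n, ∀ x ∈ Ici X, HasDerivWithinAt (Y r) (Y (r + 1) x) (Ici X) x :=
    fun r hr x hx => hZ.hasDerivWithinAt_sum hQ hL hr hx
  have hYn : ∀ x ∈ Ici X, Y n x = Q x * Y 0 x := by
    intro x hx
    have hn' : (n : ℂ) ≠ 0 := Nat.cast_ne_zero.2 (by omega)
    simp [hYdef, omega_pow_self, qpow, div_self hn', hL.2 x hx]
  have hYc : ContinuousOn (Y n) (Ici X) := by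
    refine ContinuousOn.congr (hQ.continuousOn.mul fun x hx => ?_) hYn
    exact (hYd 0 (by omega) x hx).continuousWithinAt
  have hit := iteratedDerivWithin_eqOn (uniqueDiffOn_Ici X) hYd
  rw [← hY0]
  refine ⟨⟨contDiffOn_of_hasDerivWithinAt (uniqueDiffOn_Ici X) hYd hYc, fun x hx => ?_⟩, hit⟩
  rw [hit n le_rfl hx, hYn x hx]

end

end LiouvilleGreen

/-! ### Assembly of the theorem -/

open LiouvilleGreen

theorem mainTheorem1 (n : ℕ) (hn : 1 ≤ n) (M : ℕ) (hM : 2 ≤ M) (X : ℝ) (Q L : ℝ → ℂ)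
    (S : ℕ → ℝ → Matrix (Fin n) (Fin n) ℂ)
    (hQ : ContDiffOn ℝ 2 Q (Set.Ici X))
    (hL : LiouvilleGreen.IsLogOn X Q L)
    (hS : ∀ m, 2 ≤ m → m ≤ M - 1 → ∀ i j, ContDiffOn ℝ 1 (fun x => S m x i j) (Set.Ici X))
    (hSM : ∀ i j, ContinuousOn (fun x => S M x i j) (Set.Ici X))
    (hP : ∀ m, 1 ≤ m → m ≤ M - 1 → ∀ x ∈ Set.Ici X,
      IsUnit (1 + LiouvilleGreen.Pmat n X Q L S m x))
    (hsign : ∀ j k : Fin n,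
      (∀ x ∈ Set.Ici X, 0 ≤ LiouvilleGreen.reGap n L S M j k x) ∨
      (∀ x ∈ Set.Ici X, LiouvilleGreen.reGap n L S M j k x ≤ 0))
    (hdiv : ∀ j k : Fin n, j ≠ k →
      Filter.Tendsto (fun x => |∫ t in X..x, LiouvilleGreen.reGap n L S M j k t|)
        Filter.atTop Filter.atTop)
    (hint : ∀ i j : Fin n, MeasureTheory.IntegrableOn
      (fun t => LiouvilleGreen.qroot n L t * LiouvilleGreen.Rmat n X Q L S M t i j)
      (Set.Ici X)) :
    ∀ k : Fin n, ∃ (y : ℝ → ℂ) (η : Fin n → ℝ → ℂ),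
      LiouvilleGreen.IsSolution n X Q y ∧
      (∀ r : ℕ, 1 ≤ r → r ≤ n → ∀ x ∈ Set.Ici X,
        iteratedDerivWithin (r - 1) y (Set.Ici X) x =
          LiouvilleGreen.qpow L (-((n : ℂ) + 1 - 2 * (r : ℂ)) / (2 * (n : ℂ))) x *
          (LiouvilleGreen.omega n k ^ (r - 1) +
            ∑ j : Fin n, LiouvilleGreen.omega n j ^ (r - 1) *
              (η j x + LiouvilleGreen.Ptot n X Q L S M x j k +
                ∑ l : Fin n, LiouvilleGreen.Ptot n X Q L S M x j l * η l x)) *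
          Complex.exp (∫ t in X..x, LiouvilleGreen.qroot n L t *
            (LiouvilleGreen.omega n k + LiouvilleGreen.delta S M k t))) ∧
      (∀ j : Fin n, Filter.Tendsto (η j) Filter.atTop (nhds 0)) ∧
      ((n : ℝ) * LiouvilleGreen.errInt n X Q L S M < 1 →
        ∀ j : Fin n, ∀ x ∈ Set.Ici X,
          ‖η j x‖ ≤ LiouvilleGreen.errInt n X Q L S M /
            (1 - (n : ℝ) * LiouvilleGreen.errInt n X Q L S M)) := by
  intro k
  have hqc : ContinuousOn (qroot n L) (Ici X) :=
    (contDiffOn_qpow (hL.contDiffOn hQ) _).continuousOn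
  have hδc : ∀ j, ContinuousOn (delta S M j) (Ici X) := fun j =>
    continuousOn_delta hS hSM le_rfl j
  have hRc := continuousOn_Rmat hQ hL hS hSM hP M le_rfl
  have hPd : ∀ m, 1 ≤ m → m ≤ M - 1 → ∀ i j,
      ContDiffOn ℝ 1 (fun x => Pmat n X Q L S m x i j) (Ici X) :=
    fun m h1 h2 i j => contDiffOn_Pmat hQ hL hS h1 h2 i j
  obtain ⟨η, hη, hη0, hηb⟩ := exists_levinson_solution X
    (fun j x => (omega n j - omega n k + delta S M j x
      - delta S M k x) * qroot n L x)
    (fun j => ((continuousOn_const.add (hδc j)).sub (hδc k)).mul hqc)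
    (fun i j x => qroot n L x * Rmat n X Q L S M x i j)
    (fun i j => hqc.mul (continuousOn_matrix.1 hRc i j))
    (fun t => ‖qroot n L t‖ *
      entryMax (Rmat n X Q L S M t))
    (integrableOn_qroot_mul_entryMax k hqc hRc hint)
    (fun i j t _ => by
      rw [norm_mul]
      exact mul_le_mul_of_nonneg_left (norm_le_entryMax _ i j) (norm_nonneg _))
    (fun j => by
      -- For `j = k` the gap vanishes identically, so the nonnegative alternative applies, where no
      -- divergence is required.
      by_cases hjk : j = k
      · left; intro t _; simp [hjk]
      · exact (hsign j k).imp_right fun h =>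
          ⟨h, tendsto_integral_atBot h (hdiv j k hjk)⟩)
    k (fun x _ => by simp)
  have hZM := isSystemSolution_of_reduced hQ hL k
    (hqc.mul (continuousOn_const.add (hδc k))) hη
  have hZ1 := IsSystemSolution.to_first hPd hP (M - 1) le_rfl _
    (by rwa [Nat.sub_add_cancel (by omega)])
  obtain ⟨hsol, hder⟩ := hZ1.isSolution hn hQ hL
  refine ⟨_, fun j x => η x j, hsol, fun r hr1 hrn x hx => ?_, hη0, fun h j x hx => ?_⟩
  · rw [hder (r - 1) (by omega) x hx]
    simp only [Ptot_mulVec]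
    set p := qpow L (-(((n : ℂ) - 1) / (2 * n))) x with hp
    set e := Complex.exp (∫ t in X..x, qroot n L t * (omega n k + delta S M k t))
    set a : Fin n → ℂ := fun j => η x j + Ptot n X Q L S M x j k
      + ∑ l, Ptot n X Q L S M x j l * η x l
    -- The exponents add up: `(r-1)/n - (n-1)/(2n) = -(n+1-2r)/(2n)`.
    have hpow : qpow L (-((n : ℂ) + 1 - 2 * (r : ℂ)) / (2 * (n : ℂ))) x
        = qpow L ((r - 1 : ℕ) / n) x * p := by
      have hn' : (n : ℂ) ≠ 0 := Nat.cast_ne_zero.2 (by omega)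
      rw [hp, ← qpow_add]
      congr 1
      push_cast [Nat.cast_sub hr1]
      field_simp
      ring
    have hsum : ∑ j, omega n j ^ (r - 1) * (p * e * ((Pi.single k 1 : Fin n → ℂ) j + a j))
        = p * e * (omega n k ^ (r - 1) + ∑ j, omega n j ^ (r - 1) * a j) := by
      have h1 : ∑ j, omega n j ^ (r - 1) * (Pi.single k 1 : Fin n → ℂ) j = omega n k ^ (r - 1) := by
        simp [Pi.single_apply]
      rw [← h1, ← Finset.sum_add_distrib, Finset.mul_sum]
      exact Finset.sum_congr rfl fun j _ => by ring
    rw [hpow, hsum]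
    ring
  · have hI : ∫ t in Ici X, ‖qroot n L t‖ * entryMax (Rmat n X Q L S M t)
        = errInt n X Q L S M := rfl
    rw [hI, Fintype.card_fin] at hηb
    exact hηb h j x hx
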